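/- Let $N\ge 2$, let $q\in\mathbb C$ be nonzero, and let $m_1,\dots,m_N\ge 0$ be integers. Let $\bar u^j=(u^j_1,\dots,u^j_{m_j})$ for $1\le j\le N-1$ and $\bar v^j=(v^j_1,\dots,v^j_{m_j})$ for $1\le j\le N$ be tuples of complex numbers, where all the $u^j_a$ are pairwise distinct. For tuples $\bar x,\bar y$ write $q\bar x-q^{-1}\bar y:=\prod_{a,b}(qx_a-q^{-1}y_b)$. **Grid partition function.** Let $V=\mathbb C^N$ have basis $e_1,\dots,e_N$ and matrix units $E_{ij}$, and put $$R(u,v)=(qu-q^{-1}v)\sum_{i}E_{ii}\otimes E_{ii}+\sum_{i<j}(u-v)(E_{ii}\otimes E_{jj}+E_{jj}\otimes E_{ii})+\sum_{i<j}\big((q-q^{-1})v\,E_{ij}\otimes E_{ji}+(q-q^{-1})u\,E_{ji}\otimes E_{ij}\big).$$ For $\xi=(\xi_1,\dots,\xi_n)$ define operators $T_{ij}(u;\xi)$ on $V^{\otimes n}$ by $R_{0n}(u,\xi_n)\cdots R_{01}(u,\xi_1)=\sum_{i,j}E_{ij}\otimes T_{ij}(u;\xi)$, where $E_{ij}$ acts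 on the space with label $0$, and $T_{ij}(\bar x;\xi)=\prod_a T_{ij}(x_a;\xi)$. With $\xi=(\bar v^1,\dots,\bar v^{N-1})$ (concatenation) and $n=m_1+\cdots+m_{N-1}$, let $$H(\bar u^1,\dots,\bar u^{N-1}|\bar v^1,\dots,\bar v^{N-1})=e^*_{1^{m_1},\dots,(N-1)^{m_{N-1}}}\,T_{N1}(\bar u^1;\xi)\,T_{N2}(\bar u^2;\xi)\cdots T_{N,N-1}(\bar u^{N-1};\xi)\,e_{N^{n}} .$$ **Weight function.** Let $\boldsymbol I=(i_1,\dots,i_L)\in\{1,\dots,N\}^L$, let $I^p=\{s: i_s\le p\}$ with $k_p=|I^p|$, let $I^{p}_1<\dots<I^p_{k_p}$ be the elements of $I^p$, and let $\widetilde I^p_a$ be the position of $I^p_a$ in $I^{p+1}$ (in increasing order, counted from $1$). For $\bar x\in\mathbb C^{k}$, $\bar y\in\mathbb C^{l}$ and $J_1,\dots,J_k\in\{1,\dots,l\}$ put $$\Lambda(\bar x,\bar y;J)=\prod_{a=1}^{k}\Big(\prod_{i<J_a}(x_a-y_i)\cdot(q-q^{-1})x_a\cdot\prod_{i>J_a}(qx_a-q^{-1}y_i)\Big)\prod_{a<b}\frac{q^{-1}x_a-qx_b}{x_a-x_b}.$$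 For $\bar x^p\in\mathbb C^{k_p}$ $(1\le p\le N-1)$ and $\bar w\in\mathbb C^L$, let $$W(\bar x^1,\dots,\bar x^{N-1}|\bar w|\boldsymbol I)=\sum_{\sigma_1\in S_{k_1}}\cdots\sum_{\sigma_{N-1}\in S_{k_{N-1}}}\ \prod_{p=1}^{N-2}\Lambda(\bar x^p_{\sigma_p},\bar x^{p+1}_{\sigma_{p+1}};\widetilde I^p)\cdot\Lambda(\bar x^{N-1}_{\sigma_{N-1}},\bar w;I^{N-1}),$$ where $\bar x_\sigma=(x_{\sigma(1)},\dots,x_{\sigma(k)})$. **Claim.** Put $$D=\prod_{j=1}^{N-1}(q\bar u^j-q^{-1}\bar v^N)\prod_{\ell=1}^{N-2}\prod_{j=1}^{\ell}\prod_{k=1}^{\ell+1}(q\bar u^j-q^{-1}\bar u^k)$$ and assume $D\ne 0$. Then $$H(\bar u^1,\dots,\bar u^{N-1}|\bar v^1,\dots,\bar v^{N-1})=\frac1D\;W\big(\bar u^1,\ \bar u^1\cup\bar u^2,\ \dots,\ \bar u^1\cup\cdots\cup\bar u^{N-1}\,\big|\,\bar v^1,\dots,\bar v^N\,\big|\,1^{m_1},2^{m_2},\dots,N^{m_N}\big),$$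 where unions of tuples are concatenations in the displayed order. -/

import Mathlib

open scoped Kronecker

noncomputable section

/-!
Conventions.  The rank is `N`, and colors `1, …, N` are the elements `0, …, N - 1` of `Fin N`.
Families of parameter sets `u¹, u², …` are written `u 0, u 1, …` with `u j : Fin (m j) → ℂ`, so that
`m j` is the number of elements of the set with label `j + 1`.
Endomorphisms are given by their matrices in the standard bases: those of `V` are indexed by
`Fin N`, those of `V ⊗ V` by `Fin N × Fin N`, those of `V₁ ⊗ ⋯ ⊗ V_n` by the color sequences
`Fin n → Fin N`, and those of `V₀ ⊗ V₁ ⊗ ⋯ ⊗ V_n` by `Fin N × (Fin n → Fin N)`.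
-/

namespace TrigWeight

/-! ### The R-matrix, the L-operator and the grid partition function -/

/-- The matrix unit `E_{ij}`, with `E_{ij} e_k = δ_{jk} e_i`. -/
def E {N : ℕ} (i j : Fin N) : Matrix (Fin N) (Fin N) ℂ := Matrix.single i j 1

/-- The trigonometric `R`-matrix `R(u, v)` on `V ⊗ V`. -/
def R (N : ℕ) (q u v : ℂ) : Matrix (Fin N × Fin N) (Fin N × Fin N) ℂ :=
  (q * u - q⁻¹ * v) • ∑ i : Fin N, E i i ⊗ₖ E i i
    + ∑ i : Fin N, ∑ j : Fin N with i < j,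
        (u - v) • (E i i ⊗ₖ E j j + E j j ⊗ₖ E i i)
    + ∑ i : Fin N, ∑ j : Fin N with i < j,
        (((q - q⁻¹) * v) • (E i j ⊗ₖ E j i) + ((q - q⁻¹) * u) • (E j i ⊗ₖ E i j))

/-- `R_{0k}(u, w)` on `V₀ ⊗ V₁ ⊗ ⋯ ⊗ V_n`: the `R`-matrix acting on the auxiliary space `V₀`
(first factor) and the `k`-th quantum space (second factor), the identity on the other spaces. -/
def R0 (N : ℕ) {n : ℕ} (q u w : ℂ) (k : Fin n) :
    Matrix (Fin N × (Fin n → Fin N)) (Fin N × (Fin n → Fin N)) ℂ :=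
  Matrix.of fun x y =>
    if ∀ l, l ≠ k → x.2 l = y.2 l then R N q u w (x.1, x.2 k) (y.1, y.2 k) else 0

/-- `T^vect(u; ξ) = R_{0n}(u, ξ_n) ⋯ R_{02}(u, ξ_2) R_{01}(u, ξ_1)`. -/
def Tvect (N : ℕ) {n : ℕ} (q u : ℂ) (ξ : Fin n → ℂ) :
    Matrix (Fin N × (Fin n → Fin N)) (Fin N × (Fin n → Fin N)) ℂ :=
  (List.ofFn fun k : Fin n => R0 N q u (ξ k) k).reverse.prod

/-- The element `T_{ij}(u; ξ)` of the L-operator, acting on `V₁ ⊗ ⋯ ⊗ V_n`; it is determined by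
`T^vect(u; ξ) = ∑ E_{ij} ⊗ T_{ij}(u; ξ)`. -/
def T (N : ℕ) {n : ℕ} (q : ℂ) (i j : Fin N) (u : ℂ) (ξ : Fin n → ℂ) :
    Matrix (Fin n → Fin N) (Fin n → Fin N) ℂ :=
  Matrix.of fun s t => Tvect N q u ξ (i, s) (j, t)

/-- The product of the operators `T_{ij}(x; ξ)` over all `x` in the set `x_1, …, x_l`. -/
def Tprod (N : ℕ) {n l : ℕ} (q : ℂ) (i j : Fin N) (x : Fin l → ℂ) (ξ : Fin n → ℂ) :
    Matrix (Fin n → Fin N) (Fin n → Fin N) ℂ :=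
  (List.ofFn fun a : Fin l => T N q i j (x a) ξ).prod

/-- The first `p` sets `w¹, …, w^p` of a family, listed one after the other: first the elements
of `w¹` in their order, then those of `w²`, and so on. -/
def concat {m : ℕ → ℕ} (w : (j : ℕ) → Fin (m j) → ℂ) (p : ℕ) :
    Fin (∑ j : Fin p, m j) → ℂ :=
  fun a => w (finSigmaFinEquiv.symm a).1 (finSigmaFinEquiv.symm a).2

/-- The color sequence `(1^{m_1}, 2^{m_2}, …, p^{m_p})`, with colors in `Fin p`. -/
def stdColor (m : ℕ → ℕ) (p : ℕ) : Fin (∑ j : Fin p, m j) → Fin p :=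
  fun a => (finSigmaFinEquiv.symm a).1

/-- The partition function on a rectangular grid for `N = r + 2`,
`H(u¹, …, u^{N-1} | v¹, …, v^{N-1}) =
  e^*_{1^{m_1}, …, (N-1)^{m_{N-1}}} T_{N1}(u¹; ξ) ⋯ T_{N,N-1}(u^{N-1}; ξ) e_{N, …, N}`
with `ξ = (v¹, …, v^{N-1})`. -/
def gridH (r : ℕ) (q : ℂ) (m : ℕ → ℕ) (u v : (j : ℕ) → Fin (m j) → ℂ) : ℂ :=
  (List.ofFn fun j : Fin (r + 1) =>
      Tprod (r + 2) q (Fin.last (r + 1)) j.castSucc (u j) (concat v (r + 1))).prod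
    (fun a => (stdColor m (r + 1) a).castSucc) (fun _ => Fin.last (r + 1))

/-! ### The trigonometric weight functions -/

/-- For a color sequence `c` of length `L`: `i` is one of its coordinates (counted from `0`) and
has one of the colors `1, …, p`; that is, `i` belongs to the coordinate set `I^p`. -/
def Colored {N L : ℕ} (c : Fin L → Fin N) (p i : ℕ) : Prop :=
  ∃ h : i < L, (c ⟨i, h⟩ : ℕ) < p

instance {N L : ℕ} (c : Fin L → Fin N) (p : ℕ) : DecidablePred (Colored c p) :=
  fun i => inferInstanceAs (Decidable (∃ h : i < L, (c ⟨i, h⟩ : ℕ) < p))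

/-- The `a`-th smallest element `I^p_a` of `I^p` (`a` and the coordinates counted from `0`). -/
def pos {N L : ℕ} (c : Fin L → Fin N) (p a : ℕ) : ℕ := Nat.nth (Colored c p) a

/-- The position `Ĩ^p_a` of `I^p_a` after the elements of `I^{p+1}` have been relabelled by
`0, 1, 2, …` in increasing order. -/
def relPos {N L : ℕ} (c : Fin L → Fin N) (p a : ℕ) : ℕ :=
  Nat.count (Colored c (p + 1)) (pos c p a)

/-- The contribution of one layer with variables `x_1, …, x_k`, next layer `y_1, …, y_l` and
positions `J_1, …, J_k`:
`∏_a (∏_{i < J_a} (x_a - y_i) · (q - q⁻¹) x_a · ∏_{i > J_a} (q x_a - q⁻¹ y_i))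
  · ∏_{a < b} (q⁻¹ x_a - q x_b) / (x_a - x_b)`. -/
def layer (q : ℂ) {k l : ℕ} (x : Fin k → ℂ) (y : Fin l → ℂ) (J : Fin k → ℕ) : ℂ :=
  (∏ a : Fin k,
      ((∏ i : Fin l with i.val < J a, (x a - y i))
        * ((q - q⁻¹) * x a)
        * ∏ i : Fin l with J a < i.val, (q * x a - q⁻¹ * y i)))
    * ∏ a : Fin k, ∏ b : Fin k with a < b, (q⁻¹ * x a - q * x b) / (x a - x b)

/-- The trigonometric weight function `W(x¹, …, x^{N-1} | v | I)` for `N = r + 2`.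
The set `x^{p+1}` is `x p`, with `k p` elements, and `c` is the color sequence `I`.
As usual, it is considered for `k_p = |I^p|`, the number of coordinates with a color in
`1, …, p`. -/
def W (r : ℕ) (q : ℂ) {L : ℕ} (k : Fin (r + 1) → ℕ) (x : (p : Fin (r + 1)) → Fin (k p) → ℂ)
    (v : Fin L → ℂ) (c : Fin L → Fin (r + 2)) : ℂ :=
  ∑ σ : (p : Fin (r + 1)) → Equiv.Perm (Fin (k p)),
    (∏ p : Fin r,
        layer q (x p.castSucc ∘ σ p.castSucc) (x p.succ ∘ σ p.succ)
          (fun a => relPos c ((p : ℕ) + 1) a))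
      * layer q (x (Fin.last r) ∘ σ (Fin.last r)) v (fun a => pos c (r + 1) a)

/-- The specialization
`W(u¹, u¹ ∪ u², …, u¹ ∪ ⋯ ∪ u^{N-1} | v¹, …, v^N | 1^{m_1}, 2^{m_2}, …, N^{m_N})`
for `N = r + 2`. -/
def specW (r : ℕ) (q : ℂ) (m : ℕ → ℕ) (u v : (j : ℕ) → Fin (m j) → ℂ) : ℂ :=
  W r q (fun p : Fin (r + 1) => ∑ j : Fin ((p : ℕ) + 1), m j)
    (fun p => concat u ((p : ℕ) + 1)) (concat v (r + 2)) (stdColor m (r + 2))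

/-! ### The normalizing product -/

/-- `q x - q⁻¹ y` for sets `x`, `y`: the product of `q x_a - q⁻¹ y_b` over all pairs. -/
def qDiff (q : ℂ) {k l : ℕ} (x : Fin k → ℂ) (y : Fin l → ℂ) : ℂ :=
  ∏ a : Fin k, ∏ b : Fin l, (q * x a - q⁻¹ * y b)

/-- `∏_{j=1}^{N-1} (q u^j - q⁻¹ v^N) ∏_{ℓ=1}^{N-2} ∏_{j=1}^{ℓ} ∏_{k=1}^{ℓ+1} (q u^j - q⁻¹ u^k)`
for `N = r + 2`. -/
def denom (r : ℕ) (q : ℂ) (m : ℕ → ℕ) (u v : (j : ℕ) → Fin (m j) → ℂ) : ℂ :=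
  (∏ j ∈ Finset.range (r + 1), qDiff q (u j) (v (r + 1)))
    * ∏ l ∈ Finset.range r, ∏ j ∈ Finset.range (l + 1), ∏ k ∈ Finset.range (l + 2),
        qDiff q (u j) (u k)

end TrigWeight

end

/-! The identity `D * H = W` (`denom_mul_gridH`) holds for every nonzero `q` and pairwise distinct
`u`; the assumption `D ≠ 0` serves only to divide. It is proved by a nested Bethe ansatz in which
the inner wave function is chosen to be frozen.

For a wave function `Ψ` of (parameter, color) pairs with the exchange property `IsExch`, the vector
`nest q ξ xs Ψ` sums `Ψ` against products of the operators `T_{Nj}`. It is computed in two ways.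

For any such `Ψ`, the component with prescribed colors below `N` followed by letters `N` is a sum
over permutations of `layer` times `Ψ` at permuted parameters (`nest_layer_of_generic`). This is
Lagrange interpolation in the first inhomogeneity `z`. The component has degree at most `n` in `z`
when there are `n + 1` operators, and at `z = x_b` it factors: the operator with parameter `x_b` can
be moved to the front by the exchange relations (`nest_perm`), and `R(z, z)` is proportional to the
permutation, which freezes the first site (`nest_freeze`).

For the special `Ψ` given by the same kind of created vector in rank one less, with inhomogeneities
`u¹, …, u^{r+1}` and operators at `u¹, …, u^r`, the inner grid is completely frozen
(`create_frozen`). Only one color sequence survives, and the nested sum collapses to a multiple of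
the created vector of the next rank (`nest_opList`).

Comparing the two gives a recursion in the rank, `pairProd_mul_create`, whose iteration produces all
layers of `W` (`normRec_mul_create`). The sites `v^N`, all of color `N`, contribute only the scalar
`∏_j (q u^j - q⁻¹ v^N)` (`create_append_replicate`). Interpolation needs `q x_a - q⁻¹ x_b ≠ 0`; this
is removed by continuity in `q`. -/

open scoped Kronecker

noncomputable section

namespace TrigWeight

/-! ### Entries of the R-matrix -/

/-- The diagonal weight: the entry of `R(x, y)` at `(a, b), (a, b)`. -/
def Rdiag {N : ℕ} (q x y : ℂ) (a b : Fin N) : ℂ := if a = b then q * x - q⁻¹ * y else x - y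

/-- The exchange weight: the entry of `R(x, y)` at `(a, b), (b, a)` for `a ≠ b`. -/
def Rexch {N : ℕ} (q x y : ℂ) (a b : Fin N) : ℂ :=
  if a < b then (q - q⁻¹) * y else if b < a then (q - q⁻¹) * x else 0

/-- The entry of `R(x, y)` at `(a, b), (c, d)`. -/
def Rw {N : ℕ} (q x y : ℂ) (a b c d : Fin N) : ℂ :=
  (if a = c ∧ b = d then Rdiag q x y a b else 0) + if a = d ∧ b = c then Rexch q x y a b else 0

theorem R_apply (N : ℕ) (q x y : ℂ) (a b c d : Fin N) :
    R N q x y (a, b) (c, d) = Rw q x y a b c d := by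
  unfold R Rw Rdiag Rexch E
  simp only [Matrix.add_apply, Matrix.smul_apply, Matrix.sum_apply, Matrix.kroneckerMap_apply,
    Matrix.single_apply, smul_eq_mul]
  simp only [Finset.sum_filter]
  have e1 : ∑ i : Fin N, (if i = a ∧ i = c then (1 : ℂ) else 0) * (if i = b ∧ i = d then 1 else 0)
      = if a = c ∧ b = d ∧ a = b then 1 else 0 := by
    rw [Finset.sum_eq_single a]
    · grind
    · intro i _ hi; simp [hi]
    · simp
  have key : ∀ (g : Fin N → Fin N → ℂ) (p r : Fin N), (∀ i j, ¬ (i = p ∧ j = r) → g i j = 0) →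
      ∑ i : Fin N, ∑ j : Fin N, g i j = g p r := by
    intro g p r h
    rw [Finset.sum_eq_single p, Finset.sum_eq_single r]
    · intro j _ hj; exact h _ _ (by simp [hj])
    · simp
    · intro j _ hj; exact Finset.sum_eq_zero fun k _ => h _ _ (by simp [hj])
    · simp
  have e2 : ∀ (α : ℂ), ∑ i : Fin N, ∑ j : Fin N, (if i < j then
      α * ((if i = a ∧ i = c then (1 : ℂ) else 0) * (if j = b ∧ j = d then 1 else 0)
        + (if j = a ∧ j = c then (1 : ℂ) else 0) * (if i = b ∧ i = d then 1 else 0)) else 0)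
      = if a = c ∧ b = d ∧ a ≠ b then α else 0 := by
    intro α
    have : ∀ i j : Fin N, (if i < j then
      α * ((if i = a ∧ i = c then (1 : ℂ) else 0) * (if j = b ∧ j = d then 1 else 0)
        + (if j = a ∧ j = c then (1 : ℂ) else 0) * (if i = b ∧ i = d then 1 else 0)) else 0)
      = (if i < j then α * ((if i = a ∧ i = c then (1 : ℂ) else 0) *
          (if j = b ∧ j = d then 1 else 0)) else 0) +
        (if i < j then α * ((if j = a ∧ j = c then (1 : ℂ) else 0) *
          (if i = b ∧ i = d then 1 else 0)) else 0) := by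
      intro i j; split_ifs <;> ring
    simp only [this, Finset.sum_add_distrib]
    rw [key _ a b, key _ b a]
    · rcases lt_trichotomy a b with h | h | h <;> grind
    · intro i j h; grind
    · intro i j h; grind
  have e3 : ∑ i : Fin N, ∑ j : Fin N, (if i < j then
      (q - q⁻¹) * y * ((if i = a ∧ j = c then (1 : ℂ) else 0) * (if j = b ∧ i = d then 1 else 0))
        + (q - q⁻¹) * x *
        ((if j = a ∧ i = c then (1 : ℂ) else 0) * (if i = b ∧ j = d then 1 else 0)) else 0)
      = if a = d ∧ b = c then (if a < b then (q - q⁻¹) * y else if b < a then (q - q⁻¹) * x else 0)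
        else 0 := by
    have : ∀ i j : Fin N, (if i < j then
      (q - q⁻¹) * y * ((if i = a ∧ j = c then (1 : ℂ) else 0) * (if j = b ∧ i = d then 1 else 0))
        + (q - q⁻¹) * x *
        ((if j = a ∧ i = c then (1 : ℂ) else 0) * (if i = b ∧ j = d then 1 else 0)) else 0)
      = (if i < j then (q - q⁻¹) * y * ((if i = a ∧ j = c then (1 : ℂ) else 0) *
          (if j = b ∧ i = d then 1 else 0)) else 0) +
        (if i < j then (q - q⁻¹) * x * ((if j = a ∧ i = c then (1 : ℂ) else 0) *
          (if i = b ∧ j = d then 1 else 0)) else 0) := by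
      intro i j; split_ifs <;> ring
    simp only [this, Finset.sum_add_distrib]
    rw [key _ a b, key _ b a]
    · rcases lt_trichotomy a b with h | h | h <;> grind
    · intro i j h; grind
    · intro i j h; grind
  rw [e1, e2, e3]
  congr 1
  grind

theorem Rw_eq (N : ℕ) (q x y : ℂ) (a b c d : Fin N) : Rw q x y a b c d =
    Rdiag q x y a b * (if a = c then 1 else 0) * (if b = d then 1 else 0)
    + Rexch q x y a b * (if a = d then 1 else 0) * (if b = c then 1 else 0) := by
  unfold Rw
  grind

theorem sum_Rw_mul {N : ℕ} (q x y : ℂ) (a b : Fin N) (f : Fin N → Fin N → ℂ) :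
    ∑ c, ∑ d, Rw q x y a b c d * f c d = Rdiag q x y a b * f a b + Rexch q x y a b * f b a := by
  simp only [Rw_eq, add_mul, Finset.sum_add_distrib]
  congr 1
  · rw [Finset.sum_eq_single a (by intro k _ hk; simp [Ne.symm hk]) (by simp),
      Finset.sum_eq_single b (by intro k _ hk; simp [Ne.symm hk]) (by simp)]
    simp
  · rw [Finset.sum_eq_single b (by intro k _ hk; simp [Ne.symm hk]) (by simp),
      Finset.sum_eq_single a (by intro k _ hk; simp [Ne.symm hk]) (by simp)]
    simp

/-- The Yang–Baxter equation `R₁₂(x, y) R₁₃(x, z) R₂₃(y, z) = R₂₃(y, z) R₁₃(x, z) R₁₂(x, y)`. -/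
theorem yangBaxter {N : ℕ} {q : ℂ} (hq : q ≠ 0) (x y z : ℂ) (a b c d e f : Fin N) :
    ∑ i, ∑ j, ∑ k, Rw q x y a b i j * Rw q x z i c d k * Rw q y z j k e f
      = ∑ i, ∑ j, ∑ k, Rw q y z b c j k * Rw q x z a k i f * Rw q x y i j d e := by
  set Δ : Fin N → Fin N → Fin N → ℂ := fun i j k =>
    (if i = d then 1 else 0) * (if j = e then 1 else 0) * (if k = f then 1 else 0) with hΔ
  have h1 : ∑ i, ∑ j, ∑ k, Rw q x y a b i j * Rw q x z i c d k * Rw q y z j k e f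
      = Rdiag q x y a b * (Rdiag q x z a c * (Rdiag q y z b c * Δ a b c + Rexch q y z b c * Δ a c b)
          + Rexch q x z a c * (Rdiag q y z b a * Δ c b a + Rexch q y z b a * Δ c a b))
        + Rexch q x y a b * (Rdiag q x z b c * (Rdiag q y z a c * Δ b a c
          + Rexch q y z a c * Δ b c a)
          + Rexch q x z b c * (Rdiag q y z a b * Δ c a b + Rexch q y z a b * Δ c b a)) := by
    have : ∀ i j, ∑ k, Rw q x y a b i j * Rw q x z i c d k * Rw q y z j k e f
        = Rw q x y a b i j * (Rdiag q x z i c * (Rdiag q y z j c * Δ i j c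
            + Rexch q y z j c * Δ i c j)
          + Rexch q x z i c * (Rdiag q y z j i * Δ c j i + Rexch q y z j i * Δ c i j)) := by
      intro i j
      simp only [mul_assoc, ← Finset.mul_sum]
      congr 1
      rw [Finset.sum_congr rfl (fun k _ => by rw [Rw_eq])]
      simp only [add_mul, Finset.sum_add_distrib, mul_assoc]
      rw [Finset.sum_eq_single c (by intro k _ hk; simp [Ne.symm hk]) (by simp),
        Finset.sum_eq_single i (by intro k _ hk; simp [Ne.symm hk]) (by simp)]
      simp only [Rw_eq, hΔ, if_true]
      ring
    simp only [this]
    rw [sum_Rw_mul]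
  have h2 : ∑ i, ∑ j, ∑ k, Rw q y z b c j k * Rw q x z a k i f * Rw q x y i j d e
      = Rdiag q y z b c * (Rdiag q x z a c * (Rdiag q x y a b * Δ a b c + Rexch q x y a b * Δ b a c)
          + Rexch q x z a c * (Rdiag q x y c b * Δ c b a + Rexch q x y c b * Δ b c a))
        + Rexch q y z b c * (Rdiag q x z a b * (Rdiag q x y a c * Δ a c b
          + Rexch q x y a c * Δ c a b)
          + Rexch q x z a b * (Rdiag q x y b c * Δ b c a + Rexch q x y b c * Δ c b a)) := by
    have : ∀ j k, ∑ i, Rw q y z b c j k * Rw q x z a k i f * Rw q x y i j d e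
        = Rw q y z b c j k * (Rdiag q x z a k * (Rdiag q x y a j * Δ a j k
            + Rexch q x y a j * Δ j a k)
          + Rexch q x z a k * (Rdiag q x y k j * Δ k j a + Rexch q x y k j * Δ j k a)) := by
      intro j k
      simp only [mul_assoc, ← Finset.mul_sum]
      congr 1
      rw [Finset.sum_congr rfl (fun i _ => by rw [Rw_eq])]
      simp only [add_mul, Finset.sum_add_distrib, mul_assoc]
      rw [Finset.sum_eq_single a (by intro k _ hk; simp [Ne.symm hk]) (by simp),
        Finset.sum_eq_single k (by intro k _ hk; simp [Ne.symm hk]) (by simp)]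
      simp only [Rw_eq, hΔ, if_true]
      ring
    rw [Finset.sum_comm, Finset.sum_congr rfl (fun j _ => Finset.sum_comm)]
    simp only [this]
    rw [sum_Rw_mul]
  rw [h1, h2]
  -- Each side now has eight terms, indexed by arrangements of `a, b, c`. With `hΔ` gone, `Δ` stays
  -- opaque, and the equation is checked coefficientwise for each relative order of the three
  -- colors.
  clear h1 h2 hΔ
  have e1 : ∀ (x y : ℂ) (a : Fin N), Rdiag q x y a a = q * x - q⁻¹ * y := by simp [Rdiag]
  have e2 : ∀ (x y : ℂ) (a b : Fin N), a < b → Rdiag q x y a b = x - y :=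
    fun x y a b h => by simp [Rdiag, h.ne]
  have e3 : ∀ (x y : ℂ) (a b : Fin N), b < a → Rdiag q x y a b = x - y :=
    fun x y a b h => by simp [Rdiag, h.ne']
  have e4 : ∀ (x y : ℂ) (a : Fin N), Rexch q x y a a = 0 := by simp [Rexch]
  have e5 : ∀ (x y : ℂ) (a b : Fin N), a < b → Rexch q x y a b = (q - q⁻¹) * y :=
    fun x y a b h => by simp [Rexch, h]
  have e6 : ∀ (x y : ℂ) (a b : Fin N), b < a → Rexch q x y a b = (q - q⁻¹) * x :=
    fun x y a b h => by simp [Rexch, h, h.not_gt]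
  rcases lt_trichotomy a b with hab | hab | hab <;> rcases lt_trichotomy b c with hbc | hbc | hbc <;>
  rcases lt_trichotomy a c with hac | hac | hac <;>
  (try (exfalso; order)) <;> (try subst hab) <;> (try subst hbc) <;> (try subst hac) <;>
  simp only [*] <;> field_simp <;> ring

/-! ### The L-operator on functions of color sequences -/

/-- The function `t ↦ f (a, t)`. -/
def slice {α : Type*} (a : α) : (List α → ℂ) →ₗ[ℂ] (List α → ℂ) :=
  LinearMap.funLeft ℂ ℂ (List.cons a)

@[simp] theorem slice_apply {α : Type*} (a : α) (f : List α → ℂ) (s : List α) :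
    slice a f s = f (a :: s) := rfl

theorem ext_slice {α : Type*} {f g : List α → ℂ} (h0 : f [] = g [])
    (h : ∀ a, slice a f = slice a g) : f = g := by
  funext s
  cases s with
  | nil => exact h0
  | cons a s => exact congrFun (h a) s

/-- The operator `T_{ij}(x; ξ)` acting on functions of color sequences; a function of the color
sequences of length `|ξ|` is regarded as a vector of the quantum space. -/
def mon {N : ℕ} (q x : ℂ) : List ℂ → Fin N → Fin N → (List (Fin N) → ℂ) →ₗ[ℂ] (List (Fin N) → ℂ)
  | [], i, j => if i = j then LinearMap.id else 0
  | z :: ξ, i, j => LinearMap.pi fun s => match s with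
    -- Sequences with fewer letters than sites get the value 0, while surplus letters beyond the
    -- sites are left untouched. Scalar formulas such as `mon_vac` therefore need a length
    -- hypothesis.
    | [] => 0
    | a :: s => ∑ k, ∑ b, Rw q x z k a j b • (LinearMap.proj s ∘ₗ mon q x ξ i k ∘ₗ slice b)

variable {N : ℕ} {q : ℂ}

theorem mon_nil (x : ℂ) (i j : Fin N) (f : List (Fin N) → ℂ) :
    mon q x [] i j f = if i = j then f else 0 := by
  unfold mon; split_ifs <;> simp

@[simp] theorem mon_cons_nil (x z : ℂ) (ξ : List ℂ) (i j : Fin N) (f : List (Fin N) → ℂ) :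
    mon q x (z :: ξ) i j f [] = 0 := by
  simp [mon]

theorem slice_mon_cons (x z : ℂ) (ξ : List ℂ) (i j a : Fin N) (f : List (Fin N) → ℂ) :
    slice a (mon q x (z :: ξ) i j f) = ∑ k, ∑ b, Rw q x z k a j b • mon q x ξ i k (slice b f) := by
  funext s
  simp [mon, LinearMap.sum_apply, Finset.sum_apply]

/-- The exchange relation of two L-operators. -/
theorem mon_mon_exchange (hq : q ≠ 0) (x y : ℂ) (ξ : List ℂ) (i₁ i₂ j₁ j₂ : Fin N)
    (f : List (Fin N) → ℂ) :
    ∑ k₁, ∑ k₂, Rw q x y i₁ i₂ k₁ k₂ • mon q x ξ k₁ j₁ (mon q y ξ k₂ j₂ f)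
      = ∑ k₁, ∑ k₂, Rw q x y k₁ k₂ j₁ j₂ • mon q y ξ i₂ k₂ (mon q x ξ i₁ k₁ f) := by
  induction ξ generalizing i₁ i₂ j₁ j₂ f with
  | nil =>
    simp only [mon_nil]
    rw [Finset.sum_eq_single j₁ (by intro k _ hk; simp [hk]) (by simp),
      Finset.sum_eq_single j₂ (by intro k _ hk; simp [hk]) (by simp),
      Finset.sum_eq_single i₁ (by intro k _ hk; simp [hk.symm]) (by simp),
      Finset.sum_eq_single i₂ (by intro k _ hk; simp [hk.symm]) (by simp)]
    simp
  | cons z ξ ih =>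
    apply ext_slice
    · simp
    intro a
    have hL : slice a (∑ k₁, ∑ k₂, Rw q x y i₁ i₂ k₁ k₂ •
        mon q x (z :: ξ) k₁ j₁ (mon q y (z :: ξ) k₂ j₂ f))
        = ∑ b, ∑ k₁, ∑ k₂, (∑ p, ∑ r, ∑ m,
            Rw q x y k₁ k₂ p r * Rw q x z p a j₁ m * Rw q y z r m j₂ b) •
            mon q y ξ i₂ k₂ (mon q x ξ i₁ k₁ (slice b f)) := by
      simp only [map_sum, map_smul, slice_mon_cons, Finset.smul_sum, smul_smul]
      have h1 : ∀ F : Fin N → Fin N → Fin N → Fin N → Fin N → Fin N → List (Fin N) → ℂ,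
          ∑ k₁, ∑ k₂, ∑ p, ∑ m, ∑ r, ∑ b, F k₁ k₂ p m r b
            = ∑ b, ∑ p, ∑ r, ∑ m, ∑ k₁, ∑ k₂, F k₁ k₂ p m r b := by
        intro F
        simp only [← Fintype.sum_prod_type']
        exact Fintype.sum_equiv
          ⟨fun ⟨k₁, k₂, p, m, r, b⟩ => ⟨b, p, r, m, k₁, k₂⟩,
            fun ⟨b, p, r, m, k₁, k₂⟩ => ⟨k₁, k₂, p, m, r, b⟩, fun _ => rfl, fun _ => rfl⟩
          _ _ fun _ => rfl
      have h2 : ∀ F : Fin N → Fin N → Fin N → Fin N → Fin N → List (Fin N) → ℂ,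
          ∑ p, ∑ r, ∑ m, ∑ k₁, ∑ k₂, F p r m k₁ k₂
            = ∑ k₁, ∑ k₂, ∑ p, ∑ r, ∑ m, F p r m k₁ k₂ := by
        intro F
        simp only [← Fintype.sum_prod_type']
        exact Fintype.sum_equiv
          ⟨fun ⟨p, r, m, k₁, k₂⟩ => ⟨k₁, k₂, p, r, m⟩,
            fun ⟨k₁, k₂, p, r, m⟩ => ⟨p, r, m, k₁, k₂⟩, fun _ => rfl, fun _ => rfl⟩
          _ _ fun _ => rfl
      refine (h1 _).trans ?_
      refine Finset.sum_congr rfl fun b _ => ?_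
      simp only [Finset.sum_smul]
      refine Eq.trans ?_ (h2 _)
      refine Finset.sum_congr rfl fun p _ => Finset.sum_congr rfl fun r _ =>
        Finset.sum_congr rfl fun m _ => ?_
      have := congrArg (fun g => (Rw q x z p a j₁ m * Rw q y z r m j₂ b) • g)
        (ih i₁ i₂ p r (slice b f))
      simp only [Finset.smul_sum, smul_smul] at this
      refine Eq.trans (Finset.sum_congr rfl fun k₁ _ => Finset.sum_congr rfl fun k₂ _ => ?_)
        (this.trans (Finset.sum_congr rfl fun k₁ _ => Finset.sum_congr rfl fun k₂ _ => ?_)) <;>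
      congr 1 <;> ring
    have hR : slice a (∑ k₁, ∑ k₂, Rw q x y k₁ k₂ j₁ j₂ •
        mon q y (z :: ξ) i₂ k₂ (mon q x (z :: ξ) i₁ k₁ f))
        = ∑ b, ∑ k₁, ∑ k₂, (∑ p, ∑ r, ∑ m,
            Rw q y z k₂ a r m * Rw q x z k₁ m p b * Rw q x y p r j₁ j₂) •
            mon q y ξ i₂ k₂ (mon q x ξ i₁ k₁ (slice b f)) := by
      simp only [map_sum, map_smul, slice_mon_cons, Finset.smul_sum, Finset.sum_smul, smul_smul]
      simp only [← Fintype.sum_prod_type']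
      refine Fintype.sum_equiv
        ⟨fun ⟨p, r, k₂, m, k₁, b⟩ => ⟨b, k₁, k₂, p, r, m⟩,
          fun ⟨b, k₁, k₂, p, r, m⟩ => ⟨p, r, k₂, m, k₁, b⟩, fun _ => rfl, fun _ => rfl⟩
        _ _ fun _ => ?_
      simp only [Equiv.coe_fn_mk]
      congr 1
      ring
    -- Both sides are combinations of the same operators on the remaining sites; their coefficients
    -- are the two sides of the Yang–Baxter equation.
    rw [hL, hR]
    refine Finset.sum_congr rfl fun b _ => Finset.sum_congr rfl fun k₁ _ =>
      Finset.sum_congr rfl fun k₂ _ => ?_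
    congr 1
    rw [yangBaxter hq]

/-- The exchange operator `P R(x, y)` at the sites `n, n + 1`. -/
def siteExch (q x y : ℂ) : ℕ → (List (Fin N) → ℂ) →ₗ[ℂ] (List (Fin N) → ℂ)
  | 0 => LinearMap.pi fun s => match s with
    | a :: b :: s => ∑ c, ∑ d, Rw q x y b a c d • LinearMap.proj (c :: d :: s)
    -- On sequences too short to contain both sites, the default is the vacuum eigenvalue, so that
    -- `siteExch_vac` holds without a length condition.
    | s => (q * x - q⁻¹ * y) • LinearMap.proj s
  | n + 1 => LinearMap.pi fun s => match s with
    | [] => (q * x - q⁻¹ * y) • LinearMap.proj []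
    | a :: s => LinearMap.proj s ∘ₗ siteExch q x y n ∘ₗ slice a

theorem siteExch_append (x y : ℂ) (f : List (Fin N) → ℂ) (p s : List (Fin N)) (a b : Fin N) :
    siteExch q x y p.length f (p ++ a :: b :: s)
      = ∑ c, ∑ d, Rw q x y b a c d * f (p ++ c :: d :: s) := by
  induction p generalizing f with
  | nil => simp [siteExch, LinearMap.sum_apply]
  | cons e p ih => simpa [siteExch] using ih (slice e f)

theorem slice_siteExch_succ (x y : ℂ) (n : ℕ) (f : List (Fin N) → ℂ) (a : Fin N) :
    slice a (siteExch q x y (n + 1) f) = siteExch q x y n (slice a f) := by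
  funext s
  simp [siteExch]

theorem slice_slice_siteExch_zero (x y : ℂ) (f : List (Fin N) → ℂ) (a b : Fin N) :
    slice b (slice a (siteExch q x y 0 f))
      = ∑ c, ∑ d, Rw q x y b a c d • slice d (slice c f) := by
  funext s
  simp [siteExch, LinearMap.sum_apply, Finset.sum_apply]

/-- Yang–Baxter for the auxiliary space and two neighbouring sites: `P R` intertwines the
L-operators whose inhomogeneities are interchanged there. -/
theorem siteExch_mon (hq : q ≠ 0) (x y u : ℂ) (p s : List ℂ) (i j : Fin N)
    (f : List (Fin N) → ℂ) :
    siteExch q x y p.length (mon q u (p ++ x :: y :: s) i j f)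
      = mon q u (p ++ y :: x :: s) i j (siteExch q x y p.length f) := by
  induction p generalizing i j f with
  | nil =>
    apply ext_slice
    · simp [siteExch]
    intro a
    apply ext_slice
    · simp only [slice_apply]
      have : ∀ (x z : ℂ) (ξ : List ℂ) (i j a : Fin N) (f : List (Fin N) → ℂ),
        mon q x (z :: ξ) i j f [a] = ∑ k, ∑ b, Rw q x z k a j b • mon q x ξ i k (slice b f) [] := by
        intro x z ξ i j a f
        have := congrFun (slice_mon_cons (q := q) x z ξ i j a f) []
        simpa [Finset.sum_apply] using this
      simp [this, siteExch]
    intro b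
    simp only [List.nil_append, List.length_nil, slice_slice_siteExch_zero, slice_mon_cons, map_sum,
      map_smul, Finset.smul_sum, smul_smul]
    have h1 : ∀ F : Fin N → Fin N → Fin N → Fin N → Fin N → Fin N → List (Fin N) → ℂ,
        ∑ c, ∑ d, ∑ k, ∑ e, ∑ l, ∑ g, F c d k e l g
          = ∑ l, ∑ e, ∑ g, ∑ k, ∑ c, ∑ d, F c d k e l g := by
      intro F
      simp only [← Fintype.sum_prod_type']
      exact Fintype.sum_equiv
        ⟨fun ⟨c, d, k, e, l, g⟩ => ⟨l, e, g, k, c, d⟩,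
          fun ⟨l, e, g, k, c, d⟩ => ⟨c, d, k, e, l, g⟩, fun _ => rfl, fun _ => rfl⟩
        _ _ fun _ => rfl
    have h2 : ∀ F : Fin N → Fin N → Fin N → Fin N → Fin N → Fin N → List (Fin N) → ℂ,
        ∑ k, ∑ d, ∑ l, ∑ c, ∑ e, ∑ g, F k d l c e g
          = ∑ l, ∑ e, ∑ g, ∑ k, ∑ c, ∑ d, F k d l c e g := by
      intro F
      simp only [← Fintype.sum_prod_type']
      exact Fintype.sum_equiv
        ⟨fun ⟨k, d, l, c, e, g⟩ => ⟨l, e, g, k, c, d⟩,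
          fun ⟨l, e, g, k, c, d⟩ => ⟨k, d, l, c, e, g⟩, fun _ => rfl, fun _ => rfl⟩
        _ _ fun _ => rfl
    refine (h1 _).trans (Eq.trans ?_ (h2 _).symm)
    refine Finset.sum_congr rfl fun l _ => Finset.sum_congr rfl fun e _ =>
      Finset.sum_congr rfl fun g _ => ?_
    have := congrArg (fun t : ℂ => t • mon q u s i l (slice g (slice e f)))
      (yangBaxter hq u x y l b a j e g).symm
    simp only [Finset.sum_smul] at this
    refine Eq.trans (Finset.sum_congr rfl fun k₁ _ => Finset.sum_congr rfl fun k₂ _ =>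
        Finset.sum_congr rfl fun k₃ _ => ?_)
      (this.trans (Finset.sum_congr rfl fun k₁ _ => Finset.sum_congr rfl fun k₂ _ =>
        Finset.sum_congr rfl fun k₃ _ => ?_)) <;>
    congr 1 <;> ring
  | cons e p ih =>
    apply ext_slice
    · simp [siteExch]
    intro a
    simp only [List.cons_append, List.length_cons, slice_siteExch_succ, slice_mon_cons, map_sum,
      map_smul, ih]

/-- The vector `e_N ⊗ ⋯ ⊗ e_N`, for every number of factors. -/
def vac (N : ℕ) : List (Fin (N + 1)) → ℂ := fun s => if ∀ a ∈ s, a = Fin.last N then 1 else 0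

@[simp] theorem vac_nil : vac N [] = 1 := by simp [vac]

theorem slice_vac (a : Fin (N + 1)) : slice a (vac N) = if a = Fin.last N then vac N else 0 := by
  funext s
  by_cases h : a = Fin.last N <;> simp [vac, h]

theorem Rw_last_last (x y : ℂ) (c d : Fin (N + 1)) :
    Rw q x y (Fin.last N) (Fin.last N) c d
      = if c = Fin.last N ∧ d = Fin.last N then q * x - q⁻¹ * y else 0 := by
  simp [Rw, Rdiag, Rexch, eq_comm]

theorem siteExch_vac (x y : ℂ) (n : ℕ) :
    siteExch q x y n (vac N) = (q * x - q⁻¹ * y) • vac N := by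
  induction n with
  | zero =>
    apply ext_slice
    · simp [siteExch]
    intro a
    apply ext_slice
    · simp [siteExch]
    intro b
    rw [slice_slice_siteExch_zero]
    simp only [map_smul, slice_vac]
    rw [Finset.sum_eq_single (Fin.last N) (by intro k _ hk; simp [hk]) (by simp),
      Finset.sum_eq_single (Fin.last N) (by intro k _ hk; simp [hk, slice_vac]) (by simp)]
    by_cases ha : a = Fin.last N <;> by_cases hb : b = Fin.last N <;>
      simp [slice_vac, Rw, Rdiag, Rexch, ha, hb]
  | succ n ih =>
    apply ext_slice
    · simp [siteExch]
    intro a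
    rw [slice_siteExch_succ, map_smul, slice_vac]
    split_ifs <;> simp [ih]

/-! ### Vectors created from the vacuum -/

/-- The vector `T_{N j₁}(x₁; ξ) ⋯ T_{N j_l}(x_l; ξ) e_{N, …, N}`. -/
def create (q : ℂ) (ξ : List ℂ) : List (ℂ × Fin (N + 1)) → List (Fin (N + 1)) → ℂ
  | [] => vac N
  | (x, j) :: l => mon q x ξ (Fin.last N) j (create q ξ l)

theorem siteExch_create (hq : q ≠ 0) (x y : ℂ) (p s : List ℂ) (l : List (ℂ × Fin (N + 1))) :
    siteExch q x y p.length (create q (p ++ x :: y :: s) l)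
      = (q * x - q⁻¹ * y) • create q (p ++ y :: x :: s) l := by
  induction l with
  | nil => exact siteExch_vac x y _
  | cons c l ih => rw [create, create, siteExch_mon hq, ih, map_smul]

/-- The exchange property of the coordinates of a vector depending on its inhomogeneities. -/
def IsExch (q : ℂ) (Ψ : List (ℂ × Fin N) → ℂ) : Prop :=
  ∀ (p s : List (ℂ × Fin N)) (x y : ℂ) (j k : Fin N),
    (q * x - q⁻¹ * y) * Ψ (p ++ (y, j) :: (x, k) :: s)
      = ∑ a, ∑ b, Rw q x y k j a b * Ψ (p ++ (x, a) :: (y, b) :: s)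

theorem IsExch.slice {Ψ : List (ℂ × Fin N) → ℂ} (h : IsExch q Ψ) (c : ℂ × Fin N) :
    IsExch q (slice c Ψ) := fun p s x y j k => h (c :: p) s x y j k

/-- Storing each inhomogeneity with the color of its site turns the operator identity
`siteExch_create` into a relation between values of a single function, which makes created vectors
admissible wave functions for `nest`. -/
theorem isExch_create (hq : q ≠ 0) (l : List (ℂ × Fin (N + 1))) :
    IsExch q fun t : List (ℂ × Fin (N + 1)) => create q (t.map Prod.fst) l (t.map Prod.snd) := by
  intro p s x y j k
  have h := congrFun (siteExch_create hq x y (p.map Prod.fst) (s.map Prod.fst) l)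
    (p.map Prod.snd ++ j :: k :: s.map Prod.snd)
  rw [show (p.map Prod.fst).length = (p.map Prod.snd).length by simp, siteExch_append] at h
  simpa using h.symm

/-- The nested sum `∑_{j₁, …, j_l} Ψ((x₁, j₁), …, (x_l, j_l)) T_{N j₁}(x₁; ξ) ⋯ T_{N j_l}(x_l; ξ)
e_{N, …, N}` over colors different from the last one. -/
def nest (q : ℂ) (ξ : List ℂ) :
    List ℂ → (List (ℂ × Fin N) → ℂ) →ₗ[ℂ] (List (Fin (N + 1)) → ℂ)
  | [] => (LinearMap.proj []).smulRight (vac N)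
  | x :: xs => ∑ j : Fin N, mon q x ξ (Fin.last N) j.castSucc ∘ₗ nest q ξ xs ∘ₗ slice (x, j)

@[simp] theorem nest_nil (ξ : List ℂ) (Ψ : List (ℂ × Fin N) → ℂ) :
    nest q ξ [] Ψ = Ψ [] • vac N := rfl

theorem nest_cons (ξ : List ℂ) (x : ℂ) (xs : List ℂ) (Ψ : List (ℂ × Fin N) → ℂ) :
    nest q ξ (x :: xs) Ψ
      = ∑ j : Fin N, mon q x ξ (Fin.last N) j.castSucc (nest q ξ xs (slice (x, j) Ψ)) := by
  simp [nest, LinearMap.sum_apply]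

theorem Rdiag_castSucc (x y : ℂ) (a b : Fin N) :
    Rdiag q x y a.castSucc b.castSucc = Rdiag q x y a b := by
  simp [Rdiag]

theorem Rexch_castSucc (x y : ℂ) (a b : Fin N) :
    Rexch q x y a.castSucc b.castSucc = Rexch q x y a b := by
  simp [Rexch]

theorem Rw_castSucc (x y : ℂ) (a b c d : Fin N) :
    Rw q x y a.castSucc b.castSucc c.castSucc d.castSucc = Rw q x y a b c d := by
  simp [Rw, Rdiag_castSucc, Rexch_castSucc]

/-- `R` acts on the color pair `(N, N)` as a scalar, so one side of the exchange relation reduces to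
one term. -/
theorem mon_last_exchange (hq : q ≠ 0) (x y : ℂ) (ξ : List ℂ) (j₁ j₂ : Fin (N + 1))
    (f : List (Fin (N + 1)) → ℂ) :
    (q * x - q⁻¹ * y) • mon q x ξ (Fin.last N) j₁ (mon q y ξ (Fin.last N) j₂ f)
      = ∑ k₁, ∑ k₂, Rw q x y k₁ k₂ j₁ j₂ •
          mon q y ξ (Fin.last N) k₂ (mon q x ξ (Fin.last N) k₁ f) := by
  rw [← mon_mon_exchange hq]
  rw [Finset.sum_eq_single (Fin.last N) (by intro k _ hk; simp [Rw_last_last, hk]) (by simp),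
    Finset.sum_eq_single (Fin.last N) (by intro k _ hk; simp [Rw_last_last, hk]) (by simp),
    Rw_last_last]
  simp

/-- `R` preserves the multiset of colors, so color `N` cannot occur in the sum and the `R`-matrix of
one rank lower remains. -/
theorem mon_castSucc_exchange (hq : q ≠ 0) (x y : ℂ) (ξ : List ℂ) (j₁ j₂ : Fin N)
    (f : List (Fin (N + 1)) → ℂ) :
    (q * x - q⁻¹ * y) •
        mon q x ξ (Fin.last N) j₁.castSucc (mon q y ξ (Fin.last N) j₂.castSucc f)
      = ∑ k₁ : Fin N, ∑ k₂ : Fin N, Rw q x y k₁ k₂ j₁ j₂ •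
          mon q y ξ (Fin.last N) k₂.castSucc (mon q x ξ (Fin.last N) k₁.castSucc f) := by
  rw [mon_last_exchange hq]
  have h1 : ∀ (a : Fin (N + 1)), Rw q x y (Fin.last N) a j₁.castSucc j₂.castSucc = 0 := by
    intro a
    simp [Rw, (Fin.castSucc_ne_last _).symm]
  have h2 : ∀ (a : Fin (N + 1)), Rw q x y a (Fin.last N) j₁.castSucc j₂.castSucc = 0 := by
    intro a
    simp [Rw, (Fin.castSucc_ne_last _).symm]
  simp only [Fin.sum_univ_castSucc, h1, h2, Rw_castSucc]
  simp

/-- Reordering the two operators produces an `R`-matrix, which the exchange property of `Ψ` absorbs.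
Both moves cost the same scalar `q x - q⁻¹ y`, which cancels. -/
theorem nest_swap (hq : q ≠ 0) {x y : ℂ} (hxy : q * x - q⁻¹ * y ≠ 0) (ξ xs : List ℂ)
    {Ψ : List (ℂ × Fin N) → ℂ} (hΨ : IsExch q Ψ) :
    nest q ξ (x :: y :: xs) Ψ = nest q ξ (y :: x :: xs) Ψ := by
  apply smul_right_injective _ hxy
  simp only [nest_cons, map_sum, Finset.smul_sum]
  have h1 : ∀ j₁ j₂ : Fin N, (q * x - q⁻¹ * y) • mon q x ξ (Fin.last N) j₁.castSucc
      (mon q y ξ (Fin.last N) j₂.castSucc (nest q ξ xs (slice (y, j₂) (slice (x, j₁) Ψ))))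
      = ∑ k₂ : Fin N, ∑ k₁ : Fin N,
          mon q y ξ (Fin.last N) k₂.castSucc (mon q x ξ (Fin.last N) k₁.castSucc (nest q ξ xs
            (Rw q x y k₁ k₂ j₁ j₂ • slice (y, j₂) (slice (x, j₁) Ψ)))) := by
    intro j₁ j₂
    rw [mon_castSucc_exchange hq, Finset.sum_comm]
    simp only [map_smul]
  have h2 : ∀ k₁ k₂ : Fin N, (q * x - q⁻¹ * y) • slice (x, k₁) (slice (y, k₂) Ψ)
      = ∑ j₁ : Fin N, ∑ j₂ : Fin N,
        Rw q x y k₁ k₂ j₁ j₂ • slice (y, j₂) (slice (x, j₁) Ψ) := by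
    intro k₁ k₂
    funext t
    simpa [Finset.sum_apply] using hΨ [] t x y k₂ k₁
  simp only [h1]
  simp only [← map_smul, h2, map_sum]
  simp only [← Fintype.sum_prod_type']
  exact Fintype.sum_equiv
    ⟨fun ⟨j₁, j₂, k₂, k₁⟩ => ⟨k₂, k₁, j₁, j₂⟩,
      fun ⟨k₂, k₁, j₁, j₂⟩ => ⟨j₁, j₂, k₂, k₁⟩, fun _ => rfl, fun _ => rfl⟩
    _ _ fun _ => rfl

theorem nest_perm (hq : q ≠ 0) (ξ : List ℂ) {xs ys : List ℂ} (h : xs.Perm ys) :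
    (∀ a ∈ xs, ∀ b ∈ xs, a ≠ b → q * a - q⁻¹ * b ≠ 0) →
    ∀ {Ψ : List (ℂ × Fin N) → ℂ}, IsExch q Ψ → nest q ξ xs Ψ = nest q ξ ys Ψ := by
  induction h with
  | nil => intros; rfl
  | cons x _ ih =>
    intro hx Ψ hΨ
    rw [nest_cons, nest_cons]
    refine Finset.sum_congr rfl fun j _ => ?_
    rw [ih (fun a ha b hb => hx a (by simp [ha]) b (by simp [hb])) (hΨ.slice _)]
  | swap x y l =>
    intro hx Ψ hΨ
    by_cases hxy : y = x
    · rw [hxy]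
    · exact nest_swap hq (hx y (by simp) x (by simp) hxy) ξ l hΨ
  | trans h₁ h₂ ih₁ ih₂ =>
    intro hx Ψ hΨ
    rw [ih₁ hx hΨ, ih₂ (fun a ha b hb => hx a (h₁.mem_iff.2 ha) b (h₁.mem_iff.2 hb)) hΨ]

/-! ### Freezing of the first site -/

/-- The row operator `∑_k T_{Nk}(z; ξ) ⊗ ⟨e_k|`. -/
def rowOp (q z : ℂ) (ξ : List ℂ) : (List (Fin (N + 1)) → ℂ) →ₗ[ℂ] (List (Fin (N + 1)) → ℂ) :=
  ∑ k, mon q z ξ (Fin.last N) k ∘ₗ slice k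

theorem rowOp_apply (z : ℂ) (ξ : List ℂ) (f : List (Fin (N + 1)) → ℂ) :
    rowOp q z ξ f = ∑ k, mon q z ξ (Fin.last N) k (slice k f) := by
  simp [rowOp, LinearMap.sum_apply]

/-- The weight `R(x, z)` at the first site is exactly the one in the exchange relation of `T_{Nj}(x;
ξ)` with `T_{Nk}(z; ξ)`. Thus `rowOp` passes through each operator, removing its first site at the
cost of a scalar. -/
theorem rowOp_mon (hq : q ≠ 0) (x z : ℂ) (ξ : List ℂ) (j : Fin (N + 1))
    (f : List (Fin (N + 1)) → ℂ) :
    rowOp q z ξ (mon q x (z :: ξ) (Fin.last N) j f)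
      = (q * x - q⁻¹ * z) • mon q x ξ (Fin.last N) j (rowOp q z ξ f) := by
  simp only [rowOp_apply, map_sum, Finset.smul_sum, slice_mon_cons, mon_last_exchange hq, map_smul]
  simp only [← Fintype.sum_prod_type']
  exact Fintype.sum_equiv
    ⟨fun ⟨a, k, b⟩ => ⟨b, k, a⟩, fun ⟨b, k, a⟩ => ⟨a, k, b⟩, fun _ => rfl, fun _ => rfl⟩
    _ _ fun _ => rfl

/-- Operators preserve the length of sequences; this allows identities known only at one length to
be used under `mon`. -/
theorem mon_congr (x : ℂ) (ξ : List ℂ) (i j : Fin N) {f g : List (Fin N) → ℂ} {s : List (Fin N)}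
    (h : ∀ t : List (Fin N), t.length = s.length → f t = g t) :
    mon q x ξ i j f s = mon q x ξ i j g s := by
  induction ξ generalizing i j f g s with
  | nil =>
    rw [mon_nil, mon_nil]
    split_ifs
    · exact h s rfl
    · rfl
  | cons z ξ ih =>
    cases s with
    | nil => simp
    | cons a s =>
      rw [← slice_apply a (mon q x (z :: ξ) i j f), ← slice_apply a (mon q x (z :: ξ) i j g),
        slice_mon_cons, slice_mon_cons]
      simp only [Finset.sum_apply, Pi.smul_apply]
      refine Finset.sum_congr rfl fun k _ => Finset.sum_congr rfl fun b _ => ?_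
      rw [ih i k]
      intro t ht
      exact h _ (by simp [ht])

theorem mon_vac (x : ℂ) (ξ : List ℂ) {s : List (Fin (N + 1))} (hs : s.length = ξ.length) :
    mon q x ξ (Fin.last N) (Fin.last N) (vac N) s
      = (ξ.map fun z => q * x - q⁻¹ * z).prod * vac N s := by
  induction ξ generalizing s with
  | nil => simp [mon_nil]
  | cons z ξ ih =>
    cases s with
    | nil => simp at hs
    | cons a s =>
      rw [← slice_apply a (mon _ _ _ _ _ _), ← slice_apply a (vac N), slice_mon_cons, slice_vac]
      simp only [slice_vac, Finset.sum_apply, Pi.smul_apply]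
      rw [Finset.sum_comm,
        Finset.sum_eq_single (Fin.last N) (by intro k _ hk; simp [hk]) (by simp)]
      have : ∀ k : Fin (N + 1), Rw q x z k a (Fin.last N) (Fin.last N)
          = if k = Fin.last N ∧ a = Fin.last N then q * x - q⁻¹ * z else 0 := by
        intro k
        unfold Rw Rdiag Rexch
        by_cases hk : k = Fin.last N <;> by_cases ha : a = Fin.last N <;> simp [hk, ha]
      simp only [this, if_true]
      by_cases ha : a = Fin.last N
      · rw [Finset.sum_eq_single (Fin.last N) (by intro k _ hk; simp [hk]) (by simp),
          ih (by simpa using hs)]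
        simp [ha, mul_assoc]
      · simp [ha]

/-- `R(z, z)` is `(q - q⁻¹) z` times the permutation: it hands the column color `j` to the first
site and feeds that site's former color into the rest of the row. -/
theorem slice_mon_self (z : ℂ) (ξ : List ℂ) (a j : Fin (N + 1)) (f : List (Fin (N + 1)) → ℂ) :
    slice a (mon q z (z :: ξ) (Fin.last N) j f)
      = if a = j then ((q - q⁻¹) * z) • rowOp q z ξ f else 0 := by
  rw [slice_mon_cons, rowOp_apply]
  have h : ∀ k b : Fin (N + 1), Rw q z z k a j b
      = if a = j ∧ k = b then (q - q⁻¹) * z else 0 := by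
    intro k b
    simp only [Rw, Rdiag, Rexch]
    rcases lt_trichotomy k a with h | h | h
    · simp only [h, h.not_gt, h.ne, if_true, if_false]; grind
    · subst h; simp only [lt_irrefl, if_true, if_false]; grind
    · simp only [h, h.not_gt, h.ne', if_true, if_false]; grind
  simp only [h]
  split_ifs with haj
  · simp [haj, Finset.smul_sum]
  · simp [haj]

theorem rowOp_vac (z : ℂ) (ξ : List ℂ) {s : List (Fin (N + 1))} (hs : s.length = ξ.length) :
    rowOp q z ξ (vac N) s = (ξ.map fun w => q * z - q⁻¹ * w).prod * vac N s := by
  rw [rowOp_apply]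
  simp only [slice_vac]
  rw [Finset.sum_eq_single (Fin.last N) (by intro k _ hk; simp [hk]) (by simp)]
  simp [mon_vac z ξ hs]

theorem rowOp_nest (hq : q ≠ 0) (z : ℂ) (ξ xs : List ℂ) (Ψ : List (ℂ × Fin N) → ℂ)
    {s : List (Fin (N + 1))} (hs : s.length = ξ.length) :
    rowOp q z ξ (nest q (z :: ξ) xs Ψ) s
      = (xs.map fun x => q * x - q⁻¹ * z).prod * (ξ.map fun w => q * z - q⁻¹ * w).prod
        * nest q ξ xs Ψ s := by
  induction xs generalizing Ψ s with
  | nil => simp [rowOp_vac z ξ hs]; ring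
  | cons x xs ih =>
    simp only [nest_cons, map_sum, rowOp_mon hq, Finset.sum_apply, Pi.smul_apply, Finset.mul_sum]
    refine Finset.sum_congr rfl fun j _ => ?_
    rw [mon_congr (g := ((xs.map fun x => q * x - q⁻¹ * z).prod
      * (ξ.map fun w => q * z - q⁻¹ * w).prod) • nest q ξ xs (slice (x, j) Ψ))]
    · simp
      ring
    · intro t ht
      simp [ih (slice (x, j) Ψ) (ht.trans hs)]

theorem rowOp_create (hq : q ≠ 0) (z : ℂ) (ξ : List ℂ) (l : List (ℂ × Fin (N + 1)))
    {s : List (Fin (N + 1))} (hs : s.length = ξ.length) :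
    rowOp q z ξ (create q (z :: ξ) l) s
      = (l.map fun c => q * c.1 - q⁻¹ * z).prod * (ξ.map fun w => q * z - q⁻¹ * w).prod
        * create q ξ l s := by
  induction l generalizing s with
  | nil => simp [create, rowOp_vac z ξ hs]
  | cons c l ih =>
    simp only [create, rowOp_mon hq, Pi.smul_apply]
    rw [mon_congr (g := ((l.map fun c => q * c.1 - q⁻¹ * z).prod
      * (ξ.map fun w => q * z - q⁻¹ * w).prod) • create q ξ l)]
    · simp
      ring
    · intro t ht
      simp [ih (ht.trans hs)]

theorem nest_freeze (hq : q ≠ 0) (z : ℂ) (ξ xs : List ℂ) (Ψ : List (ℂ × Fin N) → ℂ)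
    (a : Fin N) {s : List (Fin (N + 1))} (hs : s.length = ξ.length) :
    nest q (z :: ξ) (z :: xs) Ψ (a.castSucc :: s)
      = (q - q⁻¹) * z * ((xs.map fun x => q * x - q⁻¹ * z).prod
        * (ξ.map fun w => q * z - q⁻¹ * w).prod * nest q ξ xs (slice (z, a) Ψ) s) := by
  rw [← slice_apply a.castSucc (nest _ _ _ _), nest_cons, map_sum,
    Finset.sum_eq_single a (by intro k _ hk; simp [slice_mon_self, hk.symm]) (by simp),
    slice_mon_self, if_pos rfl, Pi.smul_apply, rowOp_nest hq z ξ xs _ hs, smul_eq_mul]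

theorem create_freeze (hq : q ≠ 0) (z : ℂ) (ξ : List ℂ) (l : List (ℂ × Fin (N + 1)))
    (j a : Fin (N + 1)) {s : List (Fin (N + 1))} (hs : s.length = ξ.length) :
    create q (z :: ξ) ((z, j) :: l) (a :: s)
      = if a = j then (q - q⁻¹) * z * ((l.map fun c => q * c.1 - q⁻¹ * z).prod
        * (ξ.map fun w => q * z - q⁻¹ * w).prod * create q ξ l s) else 0 := by
  rw [← slice_apply a (create _ _ _), create, slice_mon_self]
  split_ifs
  · rw [Pi.smul_apply, rowOp_create hq z ξ l hs, smul_eq_mul]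
  · rfl

/-! ### Pair products and completely frozen grids -/

/-- The product of `q x - q⁻¹ y` over `x` in `xs` and `y` in `ys`. -/
def pairProd (q : ℂ) (xs ys : List ℂ) : ℂ :=
  (xs.map fun x => (ys.map fun y => q * x - q⁻¹ * y).prod).prod

theorem pairProd_append_left (xs xs' ys : List ℂ) :
    pairProd q (xs ++ xs') ys = pairProd q xs ys * pairProd q xs' ys := by
  simp [pairProd]

theorem pairProd_append_right (xs ys ys' : List ℂ) :
    pairProd q xs (ys ++ ys') = pairProd q xs ys * pairProd q xs ys' := by
  simp [pairProd, List.prod_map_mul]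

theorem pairProd_cons_left (x : ℂ) (xs ys : List ℂ) :
    pairProd q (x :: xs) ys = (ys.map fun y => q * x - q⁻¹ * y).prod * pairProd q xs ys := by
  simp [pairProd]

theorem pairProd_cons_right (y : ℂ) (xs ys : List ℂ) :
    pairProd q xs (y :: ys) = (xs.map fun x => q * x - q⁻¹ * y).prod * pairProd q xs ys := by
  simp [pairProd, List.prod_map_mul]

theorem vac_eq (s : List (Fin (N + 1))) :
    vac N s = if s = List.replicate s.length (Fin.last N) then 1 else 0 := by
  unfold vac
  congr 1
  rw [List.eq_replicate_iff]
  simp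

/-- The leading inhomogeneities equal the operator parameters in order, so each operator freezes the
first remaining site to its own color. The factors `(q - q⁻¹) z` are the diagonal pairs of
`pairProd`. -/
theorem create_frozen (hq : q ≠ 0) (l : List (ℂ × Fin (N + 1))) (es : List ℂ)
    {s : List (Fin (N + 1))} (hs : s.length = l.length + es.length) :
    create q (l.map Prod.fst ++ es) l s
      = if s = l.map Prod.snd ++ List.replicate es.length (Fin.last N)
        then pairProd q (l.map Prod.fst) (l.map Prod.fst ++ es) else 0 := by
  induction l generalizing s with
  | nil =>
    simp at hs
    simp [create, vac_eq s, hs, pairProd]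
  | cons c l ih =>
    obtain ⟨z, j⟩ := c
    cases s with
    | nil => simp at hs; omega
    | cons a s =>
      have hs' : s.length = l.length + es.length := by simp at hs; omega
      simp only [List.map_cons, List.cons_append]
      rw [create_freeze hq _ _ _ _ _ (by simpa using hs'), ih hs']
      by_cases haj : a = j
      · subst haj
        by_cases h : s = l.map Prod.snd ++ List.replicate es.length (Fin.last N)
        · simp only [if_true, ← h]
          rw [pairProd_cons_left, pairProd_cons_right]
          simp [Function.comp_def]
          ring
        · simp [h]
      · simp [haj]

theorem nest_of_single (ξ xs : List ℂ) (cs : List (Fin N)) (hc : cs.length = xs.length) (κ : ℂ)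
    {Ψ : List (ℂ × Fin N) → ℂ}
    (hΨ : ∀ js : List (Fin N), js.length = xs.length →
      Ψ (xs.zip js) = if js = cs then κ else 0) :
    nest q ξ xs Ψ = κ • create q ξ (xs.zip (cs.map Fin.castSucc)) := by
  induction xs generalizing cs κ Ψ with
  | nil =>
    have := hΨ [] rfl
    simp at hc
    subst hc
    simp at this
    simp [create, this]
  | cons x xs ih =>
    cases cs with
    | nil => simp at hc
    | cons c cs =>
      rw [nest_cons, Finset.sum_eq_single c]
      · rw [ih cs (by simpa using hc) κ]
        · simp [create]
        · intro js hjs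
          have := hΨ (c :: js) (by simp [hjs])
          simpa using this
      · intro j _ hj
        rw [ih cs (by simpa using hc) 0]
        · simp
        · intro js hjs
          have := hΨ (j :: js) (by simp [hjs])
          simpa [hj] using this
      · simp

/-! ### Polynomial dependence on a parameter -/

/-- `f` is a polynomial of degree less than `d` with coefficients in `M`. -/
def IsPolyLT {M : Type*} [AddCommGroup M] [Module ℂ M] (d : ℕ) (f : ℂ → M) : Prop :=
  ∃ g : ℕ → M, ∀ z, f z = ∑ i ∈ Finset.range d, z ^ i • g i

namespace IsPolyLT

variable {M M' : Type*} [AddCommGroup M] [Module ℂ M] [AddCommGroup M'] [Module ℂ M'] {d e : ℕ}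

theorem mono {f : ℂ → M} (h : IsPolyLT d f) (hde : d ≤ e) : IsPolyLT e f := by
  obtain ⟨g, hg⟩ := h
  refine ⟨fun i => if i < d then g i else 0, fun z => ?_⟩
  rw [hg]
  simp only [smul_ite, smul_zero]
  rw [← Finset.sum_filter]
  congr 1
  ext i
  simp
  omega

theorem zero : IsPolyLT d (fun _ => 0 : ℂ → M) := ⟨0, by simp⟩

theorem const (m : M) : IsPolyLT 1 (fun _ => m) := ⟨fun _ => m, by simp⟩

theorem map (φ : M →ₗ[ℂ] M') {f : ℂ → M} (h : IsPolyLT d f) : IsPolyLT d fun z => φ (f z) := by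
  obtain ⟨g, hg⟩ := h
  exact ⟨fun i => φ (g i), fun z => by simp [hg]⟩

theorem sum {ι : Type*} (s : Finset ι) {f : ι → ℂ → M} (h : ∀ i ∈ s, IsPolyLT d (f i)) :
    IsPolyLT d fun z => ∑ i ∈ s, f i z := by
  choose! g hg using h
  refine ⟨fun j => ∑ i ∈ s, g i j, fun z => ?_⟩
  simp only [Finset.smul_sum]
  rw [Finset.sum_comm]
  exact Finset.sum_congr rfl fun i hi => hg i hi z

theorem smul (α : ℂ) {f : ℂ → M} (h : IsPolyLT d f) : IsPolyLT d fun z => α • f z :=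
  h.map (α • LinearMap.id)

theorem add {f f' : ℂ → M} (h : IsPolyLT d f) (h' : IsPolyLT d f') :
    IsPolyLT d fun z => f z + f' z := by
  obtain ⟨g, hg⟩ := h
  obtain ⟨g', hg'⟩ := h'
  exact ⟨fun i => g i + g' i, fun z => by simp [hg, hg', Finset.sum_add_distrib]⟩

theorem id_smul {f : ℂ → M} (h : IsPolyLT d f) : IsPolyLT (d + 1) fun z => z • f z := by
  obtain ⟨g, hg⟩ := h
  refine ⟨fun i => if i = 0 then 0 else g (i - 1), fun z => ?_⟩
  rw [Finset.sum_range_succ']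
  simp [hg, Finset.smul_sum, smul_smul, pow_succ']

theorem affine_smul (α β : ℂ) {f : ℂ → M} (h : IsPolyLT d f) :
    IsPolyLT (d + 1) fun z => (α + β * z) • f z := by
  have := ((h.smul α).mono (Nat.le_succ d)).add (h.id_smul.smul β)
  simpa only [add_smul, smul_smul] using this

theorem eq_of_eq {f g : ℂ → ℂ} (hf : IsPolyLT d f) (hg : IsPolyLT d g) (x : Fin d → ℂ)
    (hx : Function.Injective x) (h : ∀ i, f (x i) = g (x i)) (z : ℂ) : f z = g z := by
  obtain ⟨a, ha⟩ := hf
  obtain ⟨b, hb⟩ := hg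
  set P : (ℕ → ℂ) → Polynomial ℂ := fun a =>
    ∑ i ∈ Finset.range d, Polynomial.C (a i) * Polynomial.X ^ i with hP
  have hev : ∀ (a : ℕ → ℂ) (z : ℂ), (P a).eval z = ∑ i ∈ Finset.range d, z ^ i • a i := by
    intro a z
    rw [hP, Polynomial.eval_finsetSum]
    refine Finset.sum_congr rfl fun i _ => ?_
    rw [Polynomial.eval_mul, Polynomial.eval_C, Polynomial.eval_pow, Polynomial.eval_X, mul_comm,
      smul_eq_mul]
  have hdeg : ∀ a, (P a).degree < (Finset.univ : Finset (Fin d)).card := by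
    intro a
    rw [Finset.card_univ, Fintype.card_fin]
    refine (Polynomial.degree_sum_le _ _).trans_lt ?_
    rw [Finset.sup_lt_iff (by exact WithBot.bot_lt_coe d)]
    intro i hi
    refine (Polynomial.degree_C_mul_X_pow_le _ _).trans_lt ?_
    exact_mod_cast Finset.mem_range.1 hi
  have : P a = P b := by
    refine Polynomial.eq_of_degrees_lt_of_eval_index_eq Finset.univ hx.injOn (hdeg a) (hdeg b) ?_
    intro i _
    rw [hev, hev, ← ha, ← hb, h]
  rw [ha, hb, ← hev, ← hev, this]

theorem prod_sub {n : ℕ} (x : Fin n → ℂ) (c : ℂ) :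
    IsPolyLT (n + 1) fun z => (∏ i, (x i - z)) * c := by
  induction n with
  | zero => simpa using const c
  | succ n ih =>
    have := (ih (fun i => x i.succ)).affine_smul (x 0) (-1)
    convert this using 2 with z
    rw [Fin.prod_univ_succ, smul_eq_mul]
    ring

end IsPolyLT

theorem Rw_affine (x : ℂ) (a b c d : Fin N) :
    ∃ α β : ℂ, ∀ z, Rw q x z a b c d = α + β * z := by
  have h1 : ∃ α β : ℂ, ∀ z, Rdiag q x z a b = α + β * z := by
    unfold Rdiag
    split_ifs
    · exact ⟨q * x, -q⁻¹, fun z => by ring⟩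
    · exact ⟨x, -1, fun z => by ring⟩
  have h2 : ∃ α β : ℂ, ∀ z, Rexch q x z a b = α + β * z := by
    unfold Rexch
    split_ifs
    · exact ⟨0, q - q⁻¹, fun z => by ring⟩
    · exact ⟨(q - q⁻¹) * x, 0, fun z => by ring⟩
    · exact ⟨0, 0, fun z => by ring⟩
  obtain ⟨α, β, h1⟩ := h1
  obtain ⟨α', β', h2⟩ := h2
  unfold Rw
  refine ⟨(if a = c ∧ b = d then α else 0) + (if a = d ∧ b = c then α' else 0),
    (if a = c ∧ b = d then β else 0) + (if a = d ∧ b = c then β' else 0), fun z => ?_⟩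
  rw [h1, h2]
  split_ifs <;> ring

/-- Each operator contributes an affine factor in `z`. If the first site ends in a color below `N`,
some operator must change it from `N`, and that exchange weight `(q - q⁻¹) x` is free of `z`. The
degree saved makes as many interpolation points as operators suffice. -/
theorem isPolyLT_slice_nest (ξ xs : List ℂ) (Ψ : List (ℂ × Fin N) → ℂ) (a : Fin (N + 1)) :
    IsPolyLT (xs.length + if a = Fin.last N then 1 else 0)
      fun z => slice a (nest q (z :: ξ) xs Ψ) := by
  induction xs generalizing Ψ a with
  | nil =>
    simp only [nest_nil, map_smul, slice_vac]
    split_ifs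
    · exact (IsPolyLT.const _).mono (by simp)
    · simpa using IsPolyLT.zero
  | cons x xs ih =>
    simp only [nest_cons, map_sum, slice_mon_cons]
    refine IsPolyLT.sum _ fun j _ => IsPolyLT.sum _ fun k _ => IsPolyLT.sum _ fun b _ => ?_
    have hb := (ih (slice (x, j) Ψ) b).map (mon q x ξ (Fin.last N) k)
    obtain ⟨α, β, h⟩ := Rw_affine (q := q) x k a j.castSucc b
    by_cases hbl : b = Fin.last N
    · by_cases ha : a = Fin.last N
      · simp only [h]
        exact (hb.affine_smul α β).mono (by simp [hbl, ha])
      · have : ∀ z, Rw q x z k a j.castSucc b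
            = if k = Fin.last N ∧ a = j.castSucc then (q - q⁻¹) * x else 0 := by
          intro z
          subst hbl
          have hj : j.castSucc < Fin.last N := Fin.castSucc_lt_last j
          unfold Rw Rexch
          by_cases hk : k = Fin.last N <;> by_cases haj : a = j.castSucc <;>
            simp [hk, ha, haj, hj.ne, hj.ne', hj, hj.not_gt]
        simp only [this]
        exact (hb.smul _).mono (by simp [hbl])
    · simp only [h]
      refine (hb.affine_smul α β).mono ?_
      simp [hbl]

/-! ### Symmetrization over one layer -/

theorem layer_cons {n L : ℕ} (x₀ z : ℂ) (x : Fin n → ℂ) (y : Fin L → ℂ) :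
    layer q (Fin.cons x₀ x : Fin (n + 1) → ℂ) (Fin.cons z y : Fin (L + 1) → ℂ) (fun a => a)
      = (∏ a, (x a - z)) * ((q - q⁻¹) * x₀ * (∏ i, (q * x₀ - q⁻¹ * y i))
        * (∏ a, (q⁻¹ * x₀ - q * x a) / (x₀ - x a)) * layer q x y (fun a => a)) := by
  unfold layer
  simp only [Finset.prod_filter, Fin.prod_univ_succ, Fin.cons_zero, Fin.cons_succ, Fin.val_zero,
    Fin.val_succ, Nat.not_lt_zero, if_false, lt_self_iff_false, Nat.succ_lt_succ_iff,
    Nat.succ_pos, if_true, Finset.prod_const_one, one_mul, Fin.succ_pos, Fin.succ_lt_succ_iff,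
    Finset.prod_mul_distrib, Fin.not_lt_zero]
  ring

theorem nest_layer_of_generic (hq : q ≠ 0) {n L : ℕ} (x : Fin n → ℂ) (hx : Function.Injective x)
    (hgen : ∀ a b, a ≠ b → q * x a - q⁻¹ * x b ≠ 0) (y : Fin L → ℂ) (hL : n ≤ L)
    (c : Fin n → Fin N) {Ψ : List (ℂ × Fin N) → ℂ} (hΨ : IsExch q Ψ) :
    nest q (List.ofFn y) (List.ofFn x) Ψ
        (List.ofFn (fun i => (c i).castSucc) ++ List.replicate (L - n) (Fin.last N))
      = ∑ σ : Equiv.Perm (Fin n), layer q (x ∘ σ) y (fun a => a)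
          * Ψ (List.ofFn fun i => (x (σ i), c i)) := by
  induction n generalizing L Ψ with
  | zero =>
    simp [layer, vac]
  | succ n ih =>
    obtain ⟨L, rfl⟩ : ∃ M, L = M + 1 := ⟨L - 1, by omega⟩
    obtain ⟨z, y, rfl⟩ : ∃ (z : ℂ) (y' : Fin L → ℂ), y = Fin.cons z y' :=
      ⟨y 0, Fin.tail y, (Fin.cons_self_tail y).symm⟩
    set x' : Fin (n + 1) → Fin n → ℂ := fun b i => x (Equiv.swap 0 b i.succ) with hx'
    have hperm : ∀ b, x ∘ Equiv.swap 0 b = Fin.cons (x b) (x' b) := by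
      intro b
      funext i
      refine Fin.cases ?_ (fun i => ?_) i <;> simp [hx']
    have hlist : ∀ b, (List.ofFn x).Perm (x b :: List.ofFn (x' b)) := by
      intro b
      have := Equiv.Perm.ofFn_comp_perm (Equiv.swap 0 b) x
      rw [hperm b] at this
      simpa [List.ofFn_succ] using this.symm
    have hσ : ∀ b (τ : Equiv.Perm (Fin n)),
        x ∘ Equiv.Perm.decomposeFin.symm (b, τ) = Fin.cons (x b) (x' b ∘ τ) := by
      intro b τ
      funext i
      refine Fin.cases ?_ (fun i => ?_) i <;> simp [hx']
    have hinj : ∀ b, Function.Injective (x' b) := fun b =>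
      hx.comp ((Equiv.injective _).comp (Fin.succ_injective _))
    have hne : ∀ (b : Fin (n + 1)) (i : Fin n), Equiv.swap 0 b i.succ ≠ b := by
      intro b i h
      rw [Equiv.swap_apply_eq_iff, Equiv.swap_apply_right] at h
      exact Fin.succ_ne_zero i h
    -- Permutations are split by `b = σ 0`. Then `z` occurs only in `∏ (x' b i - z)`, a Lagrange
    -- numerator for the nodes `x`.
    have hrhs : ∀ z, ∑ σ : Equiv.Perm (Fin (n + 1)),
        layer q (x ∘ σ) (Fin.cons z y : Fin (L + 1) → ℂ) (fun a => a)
          * Ψ (List.ofFn fun i => (x (σ i), c i))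
        = ∑ b, ∑ τ : Equiv.Perm (Fin n), (∏ i, (x' b i - z)) *
          ((q - q⁻¹) * x b * (∏ i, (q * x b - q⁻¹ * y i))
            * (∏ i, (q⁻¹ * x b - q * x' b i) / (x b - x' b i))
            * (layer q (x' b ∘ τ) y (fun a => a)
              * slice (x b, c 0) Ψ (List.ofFn fun i => (x' b (τ i), c i.succ)))) := by
      intro z
      rw [← Fintype.sum_prod_type', ← Equiv.Perm.decomposeFin.symm.sum_comp]
      refine Finset.sum_congr rfl fun p _ => ?_
      obtain ⟨b, τ⟩ := p
      rw [hσ, layer_cons]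
      have e1 : ∏ a, ((x' b ∘ τ) a - z) = ∏ i, (x' b i - z) :=
        Equiv.prod_comp τ fun i => x' b i - z
      have e2 : ∏ a, (q⁻¹ * x b - q * (x' b ∘ τ) a) / (x b - (x' b ∘ τ) a)
          = ∏ i, (q⁻¹ * x b - q * x' b i) / (x b - x' b i) :=
        Equiv.prod_comp τ fun i => (q⁻¹ * x b - q * x' b i) / (x b - x' b i)
      have e3 : (List.ofFn fun i => (x (Equiv.Perm.decomposeFin.symm (b, τ) i), c i))
          = (x b, c 0) :: List.ofFn fun i => (x' b (τ i), c i.succ) := by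
        have := fun i => congrFun (hσ b τ) i
        simp only [Function.comp_apply] at this
        simp only [this]
        simp [List.ofFn_succ]
      rw [e1, e2, e3, slice_apply]
      ring
    rw [hrhs]
    have hcol : ∀ b, ∑ τ : Equiv.Perm (Fin n), layer q (x' b ∘ τ) y (fun a => a)
              * slice (x b, c 0) Ψ (List.ofFn fun i => (x' b (τ i), c i.succ))
        = nest q (List.ofFn y) (List.ofFn (x' b)) (slice (x b, c 0) Ψ)
          (List.ofFn (fun i : Fin n => (c i.succ).castSucc)
            ++ List.replicate (L - n) (Fin.last N)) := by
      intro b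
      refine (ih (x' b) (hinj b) ?_ y (by omega) (fun i => c i.succ) (hΨ.slice _)).symm
      intro i j hij
      exact hgen _ _ fun h => hij (hinj b (congrArg x h))
    simp only [← Finset.mul_sum, hcol]
    have hlhs : ∀ z, nest q (List.ofFn (Fin.cons z y : Fin (L + 1) → ℂ)) (List.ofFn x) Ψ
        (List.ofFn (fun i => (c i).castSucc) ++ List.replicate (L + 1 - (n + 1)) (Fin.last N))
        = slice (c 0).castSucc (nest q (z :: List.ofFn y) (List.ofFn x) Ψ)
          (List.ofFn (fun i : Fin n => (c i.succ).castSucc)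
            ++ List.replicate (L - n) (Fin.last N)) := by
      intro z
      simp [List.ofFn_succ]
    rw [hlhs]
    set s := List.ofFn (fun i : Fin n => (c i.succ).castSucc)
      ++ List.replicate (L - n) (Fin.last N) with hs
    -- Both sides have degree at most `n` in `z`, and the `n + 1` distinct values `x b` serve as
    -- nodes.
    refine IsPolyLT.eq_of_eq (d := n + 1)
      (f := fun z => slice (c 0).castSucc (nest q (z :: List.ofFn y) (List.ofFn x) Ψ) s)
      (g := fun z => ∑ b, (∏ i, (x' b i - z)) * ((q - q⁻¹) * x b * (∏ i, (q * x b - q⁻¹ * y i))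
            * (∏ i, (q⁻¹ * x b - q * x' b i) / (x b - x' b i))
            * nest q (List.ofFn y) (List.ofFn (x' b)) (slice (x b, c 0) Ψ) s)) ?_ ?_ x hx ?_ z
    · have := (isPolyLT_slice_nest (q := q) (List.ofFn y) (List.ofFn x) Ψ (c 0).castSucc).map
        (LinearMap.proj s)
      simpa [(Fin.castSucc_lt_last (c 0)).ne] using this
    · exact IsPolyLT.sum _ fun b _ => IsPolyLT.prod_sub _ _
    · intro b
      rw [Finset.sum_eq_single b]
      · rw [slice_apply, nest_perm hq _ (hlist b) _ hΨ, nest_freeze hq]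
        -- The numerator at its own node cancels the denominators of `layer`, leaving the scalar
        -- from `nest_freeze`.
        · have : (∏ i, (x' b i - x b)) * ∏ i, (q⁻¹ * x b - q * x' b i) / (x b - x' b i)
              = ∏ i, (q * x' b i - q⁻¹ * x b) := by
            rw [← Finset.prod_mul_distrib]
            refine Finset.prod_congr rfl fun i _ => ?_
            have : x b - x' b i ≠ 0 := sub_ne_zero.2 fun h => hne b i (hx h).symm
            field_simp
            ring
          rw [List.map_ofFn, List.map_ofFn, List.prod_ofFn, List.prod_ofFn]
          simp only [Function.comp_def]
          rw [← this]
          ring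
        · simp [hs]; omega
        · intro a ha b hb hab
          simp only [List.mem_ofFn] at ha hb
          obtain ⟨i, rfl⟩ := ha
          obtain ⟨j, rfl⟩ := hb
          exact hgen i j fun h => hab (congrArg x h)
      · intro b' _ hb'
        -- For `b' ≠ b` the node `x b` is among the remaining variables `x' b'`.
        have hz : ∏ i, (x' b' i - x b) = 0 := by
          have : Equiv.swap 0 b' b ≠ 0 := by
            intro h
            rw [Equiv.swap_apply_eq_iff, Equiv.swap_apply_left] at h
            exact hb' h.symm
          obtain ⟨i, hi⟩ := Fin.exists_succ_eq.2 this
          refine Finset.prod_eq_zero (Finset.mem_univ i) ?_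
          simp [hx', hi]
        rw [hz, zero_mul]
      · simp

/-! ### Continuity in the deformation parameter -/

theorem continuousAt_Rw (hq : q ≠ 0) (x y : ℂ) (a b c d : Fin N) :
    ContinuousAt (fun p => Rw p x y a b c d) q := by
  unfold Rw Rdiag Rexch
  split_ifs <;> fun_prop (disch := assumption)

theorem continuousAt_mon (hq : q ≠ 0) (x : ℂ) (ξ : List ℂ) (i j : Fin N)
    {f : ℂ → List (Fin N) → ℂ} (hf : ∀ s, ContinuousAt (fun p => f p s) q) (s : List (Fin N)) :
    ContinuousAt (fun p => mon p x ξ i j (f p) s) q := by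
  induction ξ generalizing i j f s with
  | nil =>
    simp only [mon_nil]
    split_ifs
    · exact hf s
    · exact continuousAt_const
  | cons z ξ ih =>
    cases s with
    | nil => simpa using continuousAt_const
    | cons a s =>
      have : ∀ p, mon p x (z :: ξ) i j (f p) (a :: s)
          = ∑ k, ∑ b, Rw p x z k a j b * mon p x ξ i k (slice b (f p)) s := by
        intro p
        rw [← slice_apply a (mon p x (z :: ξ) i j (f p)), slice_mon_cons]
        simp [Finset.sum_apply]
      simp only [this]
      refine tendsto_finsetSum _ fun k _ => tendsto_finsetSum _ fun b _ => ?_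
      exact (continuousAt_Rw hq x z k a j b).mul (ih i k (fun t => hf (b :: t)) s)

theorem continuousAt_create (hq : q ≠ 0) (ξ : List ℂ) (l : List (ℂ × Fin (N + 1)))
    (s : List (Fin (N + 1))) : ContinuousAt (fun p => create p ξ l s) q := by
  induction l generalizing s with
  | nil => exact continuousAt_const
  | cons c l ih => exact continuousAt_mon hq c.1 ξ _ c.2 ih s

theorem continuousAt_pairProd (hq : q ≠ 0) (xs ys : List ℂ) :
    ContinuousAt (fun p => pairProd p xs ys) q := by
  refine tendsto_list_prod _ fun x _ => tendsto_list_prod _ fun y _ => ?_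
  have : ContinuousAt (fun p : ℂ => p * x - p⁻¹ * y) q := by
    fun_prop (disch := assumption)
  exact this

theorem continuousAt_layer (hq : q ≠ 0) {n L : ℕ} (x : Fin n → ℂ) (y : Fin L → ℂ)
    (J : Fin n → ℕ) : ContinuousAt (fun p => layer p x y J) q := by
  unfold layer
  simp only [div_eq_mul_inv]
  fun_prop (disch := assumption)

/-- Each condition excludes the roots of `x_a p² - x_b`, a nonzero polynomial in `p` because
distinct `x_a, x_b` are not both zero. -/
theorem eventually_generic (hq : q ≠ 0) {n : ℕ} (x : Fin n → ℂ) (hx : Function.Injective x) :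
    ∀ᶠ p in nhdsWithin q {q}ᶜ, p ≠ 0 ∧ ∀ a b, a ≠ b → p * x a - p⁻¹ * x b ≠ 0 := by
  have h0 : ∀ᶠ p in nhdsWithin q {q}ᶜ, p ≠ 0 :=
    (eventually_ne_nhds hq).filter_mono nhdsWithin_le_nhds
  have h : ∀ a b, a ≠ b → ∀ᶠ p in nhdsWithin q {q}ᶜ, x a * p ^ 2 - x b ≠ 0 := by
    intro a b hab
    set P : Polynomial ℂ := Polynomial.C (x a) * Polynomial.X ^ 2 - Polynomial.C (x b) with hP
    have hP0 : P ≠ 0 := by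
      intro h
      have h2 := congrArg (fun f => Polynomial.coeff f 2) h
      have h0 := congrArg (fun f => Polynomial.coeff f 0) h
      simp [hP, Polynomial.coeff_C] at h2 h0
      exact hab (hx (h2.trans h0.symm))
    have hfin : (P.rootSet ℂ).Finite := Polynomial.rootSet_finite P ℂ
    have : {p : ℂ | p ∈ (P.rootSet ℂ) ∧ p ≠ q}.Finite := hfin.subset fun p hp => hp.1
    have hev : ∀ᶠ p in nhds q, p ∉ {p : ℂ | p ∈ (P.rootSet ℂ) ∧ p ≠ q} :=
      this.isClosed.isOpen_compl.mem_nhds (by simp)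
    filter_upwards [hev.filter_mono nhdsWithin_le_nhds, self_mem_nhdsWithin] with p hp hpq h
    refine hp ⟨?_, hpq⟩
    rw [Polynomial.mem_rootSet]
    exact ⟨hP0, by simpa [hP] using h⟩
  have h' : ∀ᶠ p in nhdsWithin q {q}ᶜ, ∀ a b, a ≠ b → x a * p ^ 2 - x b ≠ 0 := by
    rw [Filter.eventually_all]
    intro a
    rw [Filter.eventually_all]
    intro b
    by_cases hab : a = b
    · simp [hab]
    · filter_upwards [h a b hab] with p hp _ using hp
  filter_upwards [h0, h'] with p hp hp'
  refine ⟨hp, fun a b hab h => hp' a b hab ?_⟩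
  field_simp at h
  linear_combination h

/-! ### The recursion in the rank -/

section

variable (m : ℕ → ℕ)

/-- The concatenation of the first `r` parameter sets as a list. -/
def paramList {m : ℕ → ℕ} (u : (j : ℕ) → Fin (m j) → ℂ) : ℕ → List ℂ
  | 0 => []
  | r + 1 => paramList u r ++ List.ofFn (u r)

/-- The color sequence `(1^{m_1}, …, r^{m_r})` as a list. -/
def colorList (m : ℕ → ℕ) : (r : ℕ) → List (Fin r)
  | 0 => []
  | r + 1 => (colorList m r).map Fin.castSucc ++ List.replicate (m r) (Fin.last r)

theorem ofFn_sigma_succ {β : Type*} {m : ℕ → ℕ} (p : ℕ) (f : (j : Fin (p + 1)) → Fin (m j) → β) :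
    (List.ofFn fun a : Fin (∑ j : Fin (p + 1), m j) =>
        f (finSigmaFinEquiv.symm a).1 (finSigmaFinEquiv.symm a).2)
      = (List.ofFn fun a : Fin (∑ j : Fin p, m j) =>
          f (finSigmaFinEquiv.symm a).1.castSucc (finSigmaFinEquiv.symm a).2)
        ++ List.ofFn (f (Fin.last p)) := by
  have hs : ∑ j : Fin (p + 1), m j = ∑ j : Fin p, m j + m p := Fin.sum_univ_castSucc _
  rw [List.ofFn_congr hs, List.ofFn_add]
  -- A flattened index is recognized by its numerical value alone, which avoids transport along
  -- `hs`.
  have key : ∀ (a : Fin (∑ j : Fin (p + 1), m j)) (c : (j : Fin (p + 1)) × Fin (m j)),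
      (finSigmaFinEquiv c : ℕ) = a → f (finSigmaFinEquiv.symm a).1 (finSigmaFinEquiv.symm a).2
        = f c.1 c.2 := by
    intro a c h
    rw [show a = finSigmaFinEquiv c from Fin.ext h.symm, Equiv.symm_apply_apply]
  congr 2
  · funext a
    set c := finSigmaFinEquiv.symm a with hc
    have ha : a = finSigmaFinEquiv c := by simp [hc]
    refine key _ ⟨c.1.castSucc, c.2⟩ ?_
    rw [ha, finSigmaFinEquiv_apply]
    simp [finSigmaFinEquiv_apply]
  · funext a
    refine key _ ⟨Fin.last p, a⟩ ?_
    rw [finSigmaFinEquiv_apply]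
    simp

theorem ofFn_concat {m : ℕ → ℕ} (u : (j : ℕ) → Fin (m j) → ℂ) (p : ℕ) :
    List.ofFn (concat u p) = paramList u p := by
  induction p with
  | zero => simp [paramList]
  | succ p ih =>
    rw [paramList, ← ih]
    exact ofFn_sigma_succ p fun j a => u j a

theorem ofFn_stdColor (p : ℕ) : List.ofFn (stdColor m p) = colorList m p := by
  induction p with
  | zero => simp [colorList]
  | succ p ih =>
    rw [colorList, ← ih, List.map_ofFn, ← List.ofFn_const]
    exact ofFn_sigma_succ p fun j _ => j

theorem length_paramList {m : ℕ → ℕ} (u : (j : ℕ) → Fin (m j) → ℂ) (p : ℕ) :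
    (paramList u p).length = ∑ j : Fin p, m j := by
  rw [← ofFn_concat, List.length_ofFn]

theorem length_colorList (p : ℕ) : (colorList m p).length = ∑ j : Fin p, m j := by
  rw [← ofFn_stdColor, List.length_ofFn]

/-- The pairs `(u^j_a, j)` in the order of the product `T_{N1}(u¹) ⋯ T_{N,N-1}(u^{N-1})`. -/
def opList {m : ℕ → ℕ} (u : (j : ℕ) → Fin (m j) → ℂ) (r : ℕ) : List (ℂ × Fin (r + 1)) :=
  (paramList u r).zip ((colorList m r).map Fin.castSucc)

variable {m} (u : (j : ℕ) → Fin (m j) → ℂ)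

theorem map_fst_opList (r : ℕ) : (opList u r).map Prod.fst = paramList u r := by
  rw [opList, List.map_fst_zip]
  simp [length_paramList, length_colorList]

theorem map_snd_opList (r : ℕ) :
    (opList u r).map Prod.snd = (colorList m r).map Fin.castSucc := by
  rw [opList, List.map_snd_zip]
  simp [length_paramList, length_colorList]

/-- The weight function of the sorted color sequence, by recursion in the rank. -/
def weightRec (q : ℂ) : (r : ℕ) → {L : ℕ} → (Fin L → ℂ) → ℂ
  | 0, _, _ => 1
  | r + 1, _, y => ∑ σ : Equiv.Perm (Fin (∑ j : Fin (r + 1), m j)),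
      layer q (concat u (r + 1) ∘ σ) y (fun a => a) * weightRec q r (concat u (r + 1) ∘ σ)

/-- The product of `q u^j - q⁻¹ u^k` over `ℓ < r - 1`, `j ≤ ℓ`, `k ≤ ℓ + 1`. -/
def normRec (q : ℂ) : ℕ → ℂ
  | 0 => 1
  | r + 1 => normRec q r * pairProd q (paramList u r) (paramList u (r + 1))

/-- The inner vector is frozen to the sorted color sequence, so the nested sum has a single nonzero
term. -/
theorem nest_opList (hq : q ≠ 0) (ξ : List ℂ) (r : ℕ) :
    nest q ξ (paramList u (r + 1)) (fun t : List (ℂ × Fin (r + 1)) =>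
        create q (t.map Prod.fst) (opList u r) (t.map Prod.snd))
      = pairProd q (paramList u r) (paramList u (r + 1)) • create q ξ (opList u (r + 1)) := by
  refine nest_of_single ξ _ (colorList m (r + 1)) ?_ _ fun js hjs => ?_
  · rw [length_paramList, length_colorList]
  · rw [List.map_fst_zip (by omega), List.map_snd_zip (by omega)]
    have h := create_frozen hq (opList u r) (List.ofFn (u r)) (s := js) ?_
    · rw [map_fst_opList, map_snd_opList, List.length_ofFn] at h
      exact h
    · rw [hjs, paramList, List.length_append]
      congr 1
      rw [← map_fst_opList u r, List.length_map]

/-- For generic deformation parameter this compares `nest_opList` with `nest_layer_of_generic`. Both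
sides are continuous at `q ≠ 0`, since the denominators `x_a - x_b` do not involve the parameter,
and generic values accumulate at `q`. -/
theorem pairProd_mul_create (hq : q ≠ 0) (r : ℕ)
    (hu : Function.Injective (concat u (r + 1))) {L : ℕ} (y : Fin L → ℂ)
    (hL : ∑ j : Fin (r + 1), m j ≤ L) :
    pairProd q (paramList u r) (paramList u (r + 1)) *
        create q (List.ofFn y) (opList u (r + 1)) ((colorList m (r + 1)).map Fin.castSucc
          ++ List.replicate (L - ∑ j : Fin (r + 1), m j) (Fin.last (r + 1)))
      = ∑ σ : Equiv.Perm (Fin (∑ j : Fin (r + 1), m j)),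
          layer q (concat u (r + 1) ∘ σ) y (fun a => a)
            * create q (List.ofFn (concat u (r + 1) ∘ σ)) (opList u r) (colorList m (r + 1)) := by
  have hgen : ∀ p : ℂ, p ≠ 0 → (∀ a b, a ≠ b →
      p * concat u (r + 1) a - p⁻¹ * concat u (r + 1) b ≠ 0) →
      pairProd p (paramList u r) (paramList u (r + 1)) *
        create p (List.ofFn y) (opList u (r + 1)) ((colorList m (r + 1)).map Fin.castSucc
          ++ List.replicate (L - ∑ j : Fin (r + 1), m j) (Fin.last (r + 1)))
      = ∑ σ : Equiv.Perm (Fin (∑ j : Fin (r + 1), m j)),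
          layer p (concat u (r + 1) ∘ σ) y (fun a => a)
            * create p (List.ofFn (concat u (r + 1) ∘ σ)) (opList u r)
              (colorList m (r + 1)) := by
    intro p hp hp'
    have h := nest_layer_of_generic hp (concat u (r + 1)) hu hp' y hL (stdColor m (r + 1))
      (isExch_create hp (opList u r))
    rw [ofFn_concat, nest_opList u hp] at h
    have e : (List.ofFn fun i => (stdColor m (r + 1) i).castSucc)
        = (colorList m (r + 1)).map Fin.castSucc := by
      rw [← ofFn_stdColor, List.map_ofFn]
      rfl
    rw [e] at h
    simp only [List.map_ofFn] at h
    refine h.trans (Finset.sum_congr rfl fun σ _ => ?_)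
    rw [← ofFn_stdColor]
    rfl
  have hev : ∀ᶠ p in nhdsWithin q {q}ᶜ, _ = _ :=
    (eventually_generic hq (concat u (r + 1)) hu).mono fun p hp => hgen p hp.1 hp.2
  refine tendsto_nhds_unique_of_eventuallyEq ?_ ?_ hev
  · exact ((continuousAt_pairProd hq _ _).mul (continuousAt_create hq _ _ _)).tendsto.mono_left
      nhdsWithin_le_nhds
  · refine Filter.Tendsto.mono_left ?_ nhdsWithin_le_nhds
    refine tendsto_finsetSum _ fun σ _ => ?_
    exact (continuousAt_layer hq _ _ _).mul (continuousAt_create hq _ _ _)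

theorem injective_concat_of_succ {r : ℕ} (hu : Function.Injective (concat u (r + 1))) :
    Function.Injective (concat u r) := by
  rw [← List.nodup_ofFn, ofFn_concat] at hu ⊢
  exact (List.nodup_append.1 hu).1

theorem normRec_mul_create (hq : q ≠ 0) (r : ℕ) (hu : Function.Injective (concat u r)) {L : ℕ}
    (y : Fin L → ℂ) (hL : ∑ j : Fin r, m j ≤ L) :
    normRec u q r * create q (List.ofFn y) (opList u r) ((colorList m r).map Fin.castSucc
        ++ List.replicate (L - ∑ j : Fin r, m j) (Fin.last r))
      = weightRec u q r y := by
  induction r generalizing L with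
  | zero => simp [normRec, weightRec, opList, paramList, create, colorList, vac]
  | succ r ih =>
    rw [normRec, mul_assoc, pairProd_mul_create u hq r hu y hL, Finset.mul_sum, weightRec]
    refine Finset.sum_congr rfl fun σ _ => ?_
    have hs : ∑ j : Fin (r + 1), m j = ∑ j : Fin r, m j + m r := Fin.sum_univ_castSucc _
    rw [← ih (injective_concat_of_succ u hu) (concat u (r + 1) ∘ σ) (by omega), colorList,
      show ∑ j : Fin (r + 1), m j - ∑ j : Fin r, m j = m r by omega]
    ring

end

/-! ### Frozen sites at the end of the chain -/

/-- The last site carries the leftmost factor `R_{0n}`, so peeling it off exposes the row index `i`,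
whereas the defining recursion exposes the column index. -/
theorem mon_concat (x e : ℂ) (ξ : List ℂ) (i j a : Fin N) (f : List (Fin N) → ℂ)
    {s : List (Fin N)} (hs : s.length = ξ.length) :
    mon q x (ξ ++ [e]) i j f (s ++ [a])
      = ∑ k, ∑ b, Rw q x e i a k b * mon q x ξ k j (fun t => f (t ++ [b])) s := by
  induction ξ generalizing i j f s with
  | nil =>
    obtain rfl : s = [] := List.length_eq_zero_iff.1 hs
    have h := congrFun (slice_mon_cons (q := q) x e [] i j a f) []
    simp only [slice_apply] at h
    simp only [List.nil_append, h, mon_nil, Finset.sum_apply, Pi.smul_apply, smul_eq_mul]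
    rw [Finset.sum_eq_single i (by intro k _ hk; simp [hk.symm]) (by simp)]
    rw [Finset.sum_eq_single (a := j) (s := Finset.univ)
      (f := fun k => ∑ b, Rw q x e i a k b * (if k = j then fun t => f (t ++ [b]) else 0) [])
      (by intro k _ hk; simp [hk]) (by simp)]
    simp
  | cons z ξ ih =>
    cases s with
    | nil => simp at hs
    | cons c s =>
      have hs' : s.length = ξ.length := by simpa using hs
      have h := fun ξ i j f => congrFun (slice_mon_cons (q := q) x z ξ i j c f)
      simp only [slice_apply, Finset.sum_apply, Pi.smul_apply, smul_eq_mul] at h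
      simp only [List.cons_append, h, ih _ _ _ hs', Finset.mul_sum]
      simp only [← Fintype.sum_prod_type']
      refine Fintype.sum_equiv
        ⟨fun ⟨k, b, l, d⟩ => ⟨l, d, k, b⟩, fun ⟨l, d, k, b⟩ => ⟨k, b, l, d⟩,
          fun _ => rfl, fun _ => rfl⟩ _ _ fun _ => ?_
      simp only [Equiv.coe_fn_mk]
      rw [mul_left_comm]
      rfl

/-- At a last site ending in color `N`, each operator meets row color `N`; the weight for `(N, N)`
is diagonal, so the site contributes only scalars. -/
theorem create_concat (ξ : List ℂ) (e : ℂ) (l : List (ℂ × Fin (N + 1)))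
    {s : List (Fin (N + 1))} (hs : s.length = ξ.length) :
    create q (ξ ++ [e]) l (s ++ [Fin.last N])
      = (l.map fun c => q * c.1 - q⁻¹ * e).prod * create q ξ l s := by
  induction l generalizing s with
  | nil => simp [create, vac, or_imp]
  | cons c l ih =>
    rw [create, mon_concat _ _ _ _ _ _ _ hs,
      Finset.sum_eq_single (Fin.last N) (by intro k _ hk; simp [Rw_last_last, hk]) (by simp),
      Finset.sum_eq_single (Fin.last N) (by intro k _ hk; simp [Rw_last_last, hk]) (by simp),
      Rw_last_last, if_pos ⟨rfl, rfl⟩,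
      mon_congr (g := (l.map fun c => q * c.1 - q⁻¹ * e).prod • create q ξ l)]
    · simp [create, mul_assoc]
    · intro t ht
      simp [ih (ht.trans hs)]

theorem create_append_replicate (ξ es : List ℂ) (l : List (ℂ × Fin (N + 1)))
    {s : List (Fin (N + 1))} (hs : s.length = ξ.length) :
    create q (ξ ++ es) l (s ++ List.replicate es.length (Fin.last N))
      = pairProd q (l.map Prod.fst) es * create q ξ l s := by
  induction es generalizing ξ s with
  | nil => simp [pairProd, Function.comp_def]
  | cons e es ih =>
    have := ih (ξ ++ [e]) (s := s ++ [Fin.last N]) (by simp [hs])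
    rw [create_concat ξ e l hs] at this
    rw [pairProd_cons_right]
    simp only [List.append_assoc, List.cons_append, List.nil_append] at this
    rw [List.length_cons, List.replicate_succ, this]
    simp [Function.comp_def]
    ring

/-! ### The matrices of the L-operator -/

/-- The operator `M` on `V₀ ⊗ V₂ ⊗ ⋯ ⊗ V_{n+1}`, extended by the identity of `V₁`. -/
def liftMat {n : ℕ} (M : Matrix (Fin N × (Fin n → Fin N)) (Fin N × (Fin n → Fin N)) ℂ) :
    Matrix (Fin N × (Fin (n + 1) → Fin N)) (Fin N × (Fin (n + 1) → Fin N)) ℂ :=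
  Matrix.of fun x y => if x.2 0 = y.2 0 then M (x.1, Fin.tail x.2) (y.1, Fin.tail y.2) else 0

theorem sum_cons {n : ℕ} {M : Type*} [AddCommMonoid M] (g : (Fin (n + 1) → Fin N) → M) :
    ∑ t, g t = ∑ b, ∑ t : Fin n → Fin N, g (Fin.cons b t) := by
  rw [← (Fin.consEquiv fun _ : Fin (n + 1) => Fin N).sum_comp, Fintype.sum_prod_type]
  rfl

theorem liftMat_one {n : ℕ} :
    liftMat (1 : Matrix (Fin N × (Fin n → Fin N)) (Fin N × (Fin n → Fin N)) ℂ) = 1 := by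
  ext ⟨i, s⟩ ⟨j, t⟩
  simp only [liftMat, Matrix.of_apply, Matrix.one_apply, Prod.mk.injEq]
  by_cases h : s = t
  · subst h; simp
  · have : ¬ (s 0 = t 0 ∧ Fin.tail s = Fin.tail t) := by
      rintro ⟨h0, h1⟩
      exact h (by rw [← Fin.cons_self_tail s, ← Fin.cons_self_tail t, h0, h1])
    grind

theorem liftMat_mul {n : ℕ}
    (A B : Matrix (Fin N × (Fin n → Fin N)) (Fin N × (Fin n → Fin N)) ℂ) :
    liftMat (A * B) = liftMat A * liftMat B := by
  ext ⟨i, s⟩ ⟨j, t⟩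
  simp only [liftMat, Matrix.of_apply, Matrix.mul_apply, Fintype.sum_prod_type, sum_cons,
    Fin.cons_zero, Fin.tail_cons]
  split_ifs with h
  · refine Finset.sum_congr rfl fun k _ => ?_
    rw [Finset.sum_eq_single (s 0) (by intro b _ hb; simp [hb.symm]) (by simp)]
    simp [h]
  · symm
    refine Finset.sum_eq_zero fun k _ => Finset.sum_eq_zero fun b _ =>
      Finset.sum_eq_zero fun r _ => ?_
    by_cases hb : s 0 = b
    · simp [← hb, h]
    · simp [hb]

theorem liftMat_list_prod {n : ℕ}
    (l : List (Matrix (Fin N × (Fin n → Fin N)) (Fin N × (Fin n → Fin N)) ℂ)) :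
    liftMat l.prod = (l.map liftMat).prod := by
  induction l with
  | nil => simp [liftMat_one]
  | cons A l ih => simp [liftMat_mul, ih]

theorem liftMat_R0 {n : ℕ} (u w : ℂ) (k : Fin n) :
    liftMat (R0 N q u w k) = R0 N q u w k.succ := by
  ext ⟨i, s⟩ ⟨j, t⟩
  simp only [liftMat, R0, Matrix.of_apply, Fin.tail]
  have : (∀ l, l ≠ k.succ → s l = t l) ↔ (s 0 = t 0 ∧ ∀ l, l ≠ k → s l.succ = t l.succ) := by
    rw [Fin.forall_fin_succ]
    simp [(Fin.succ_ne_zero k).symm]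
  by_cases h : s 0 = t 0
  · rw [if_pos h]
    exact if_congr (by rw [this]; simp [h]) rfl rfl
  · rw [if_neg h, if_neg (fun hh => h (this.1 hh).1)]

theorem Tvect_succ {n : ℕ} (u : ℂ) (ξ : Fin (n + 1) → ℂ) :
    Tvect N q u ξ = liftMat (Tvect N q u (Fin.tail ξ)) * R0 N q u (ξ 0) 0 := by
  unfold Tvect
  rw [List.ofFn_succ, List.reverse_cons, List.prod_append, List.prod_singleton, liftMat_list_prod,
    List.map_reverse, List.map_ofFn]
  simp only [Function.comp_def, liftMat_R0]
  rfl

theorem T_succ {n : ℕ} (u : ℂ) (ξ : Fin (n + 1) → ℂ) (i j a b : Fin N) (s t : Fin n → Fin N) :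
    T N q i j u ξ (Fin.cons a s) (Fin.cons b t)
      = ∑ k, Rw q u (ξ 0) k a j b * T N q i k u (Fin.tail ξ) s t := by
  simp only [T, Matrix.of_apply, Tvect_succ, Matrix.mul_apply, Fintype.sum_prod_type, sum_cons]
  refine Finset.sum_congr rfl fun k _ => ?_
  rw [Finset.sum_eq_single a (by intro c _ hc; simp [liftMat, hc.symm]) (by simp),
    Finset.sum_eq_single t]
  · simp [liftMat, R0, R_apply, mul_comm]
    intro l hl hl'
    obtain ⟨l', rfl⟩ := Fin.exists_succ_eq.2 hl
    simp at hl'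
  · intro c _ hc
    have : ¬ ∀ l, l ≠ (0 : Fin (n + 1)) →
        (Fin.cons a c : Fin (n + 1) → Fin N) l = (Fin.cons b t : Fin (n + 1) → Fin N) l := by
      intro h
      exact hc (funext fun l => by simpa using h l.succ (Fin.succ_ne_zero l))
    simp [R0, this]
  · simp

theorem mon_eq_sum_T {n : ℕ} (x : ℂ) (ξ : Fin n → ℂ) (i j : Fin N) (f : List (Fin N) → ℂ)
    (s : Fin n → Fin N) :
    mon q x (List.ofFn ξ) i j f (List.ofFn s) = ∑ t, T N q i j x ξ s t * f (List.ofFn t) := by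
  induction n generalizing i j f with
  | zero =>
    simp [mon_nil, T, Tvect, Matrix.one_apply, Subsingleton.elim s default]
    split_ifs <;> rfl
  | succ n ih =>
    have h := congrFun (slice_mon_cons (q := q) x (ξ 0) (List.ofFn (Fin.tail ξ)) i j (s 0) f)
      (List.ofFn (Fin.tail s))
    simp only [slice_apply, Finset.sum_apply, Pi.smul_apply, smul_eq_mul, ih] at h
    rw [List.ofFn_succ, List.ofFn_succ]
    refine h.trans ?_
    conv_rhs => rw [← Fin.cons_self_tail s]
    simp only [sum_cons, T_succ, Finset.sum_mul, Finset.mul_sum, List.ofFn_succ, Fin.cons_zero,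
      Fin.cons_succ]
    simp only [← Fintype.sum_prod_type']
    refine Fintype.sum_equiv
      ⟨fun ⟨k, b, t⟩ => ⟨b, t, k⟩, fun ⟨b, t, k⟩ => ⟨k, b, t⟩,
        fun _ => rfl, fun _ => rfl⟩ _ _ fun _ => ?_
    simp [mul_assoc]

theorem create_eq_prod_T {n : ℕ} (ξ : Fin n → ℂ) (l : List (ℂ × Fin (N + 1)))
    (s : Fin n → Fin (N + 1)) :
    create q (List.ofFn ξ) l (List.ofFn s)
      = (l.map fun c => T (N + 1) q (Fin.last N) c.2 c.1 ξ).prod s fun _ => Fin.last N := by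
  induction l generalizing s with
  | nil =>
    simp [create, vac, Matrix.one_apply, funext_iff]
  | cons c l ih =>
    rw [create, mon_eq_sum_T, List.map_cons, List.prod_cons, Matrix.mul_apply]
    simp only [ih]

theorem prod_map_zip {m : ℕ → ℕ} (u : (j : ℕ) → Fin (m j) → ℂ) {A α : Type*} [Monoid A] (p : ℕ)
    (h : Fin p → α) (F : ℂ × α → A) :
    (((paramList u p).zip ((colorList m p).map h)).map F).prod
      = (List.ofFn fun j : Fin p => (List.ofFn fun a => F (u j a, h j)).prod).prod := by
  induction p with
  | zero => simp [paramList]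
  | succ p ih =>
    rw [paramList, colorList, List.map_append, List.map_map,
      List.zip_append (by simp [length_paramList, length_colorList]), List.map_append,
      List.prod_append, ih, List.ofFn_succ', List.concat_eq_append, List.prod_append,
      List.prod_singleton]
    congr 2
    rw [List.map_replicate]
    refine List.ext_getElem (by simp) fun i h₁ h₂ => ?_
    simp

theorem gridH_eq_create (r : ℕ) {m : ℕ → ℕ} (u v : (j : ℕ) → Fin (m j) → ℂ) :
    gridH r q m u v = create q (paramList v (r + 1)) (opList u (r + 1))
      ((colorList m (r + 1)).map Fin.castSucc) := by
  rw [← ofFn_stdColor, List.map_ofFn, ← ofFn_concat, create_eq_prod_T, opList, prod_map_zip]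
  rfl

/-! ### The weight function of the sorted color sequence -/

/-- For a sorted color sequence every `I^p` is an initial segment, which is why `pos` and `relPos`
become the identity below. -/
theorem stdColor_lt_iff (m : ℕ → ℕ) {N p : ℕ} (a : Fin (∑ j : Fin N, m j)) :
    (stdColor m N a : ℕ) < p ↔ (a : ℕ) < ∑ j : Fin p, m j := by
  obtain ⟨c, rfl⟩ := (finSigmaFinEquiv (n := fun j : Fin N => m j)).surjective a
  obtain ⟨j, i⟩ := c
  have hmono : ∀ {a b : ℕ}, a ≤ b → ∑ j ∈ Finset.range a, m j ≤ ∑ j ∈ Finset.range b, m j :=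
    fun h => Finset.sum_le_sum_of_subset (Finset.range_mono h)
  have hv : (finSigmaFinEquiv (n := fun j : Fin N => m j) ⟨j, i⟩ : ℕ)
      = ∑ k ∈ Finset.range j, m k + i := by
    rw [finSigmaFinEquiv_apply, Finset.sum_range]
    rfl
  have hi : (i : ℕ) < m j := i.isLt
  rw [hv, stdColor, Equiv.symm_apply_apply, ← Finset.sum_range]
  change (j : ℕ) < p ↔ _
  constructor
  · intro h
    have := hmono (Nat.succ_le_of_lt h)
    rw [Finset.sum_range_succ] at this
    omega
  · intro h
    by_contra h'
    have := hmono (not_lt.1 h')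
    omega

theorem sum_fin_mono (m : ℕ → ℕ) {p N : ℕ} (hp : p ≤ N) :
    ∑ j : Fin p, m j ≤ ∑ j : Fin N, m j := by
  rw [← Finset.sum_range, ← Finset.sum_range]
  exact Finset.sum_le_sum_of_subset (Finset.range_mono hp)

theorem colored_stdColor (m : ℕ → ℕ) {N p a : ℕ} (hp : p ≤ N) (ha : a < ∑ j : Fin p, m j) :
    Colored (stdColor m N) p a :=
  ⟨ha.trans_le (sum_fin_mono m hp), (stdColor_lt_iff m _).2 ha⟩

theorem count_colored_stdColor (m : ℕ → ℕ) {N p a : ℕ} (hp : p ≤ N) (ha : a < ∑ j : Fin p, m j) :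
    Nat.count (Colored (stdColor m N) p) a = a :=
  Nat.count_of_forall fun _ h => colored_stdColor m hp (h.trans ha)

theorem pos_stdColor (m : ℕ → ℕ) {N p a : ℕ} (hp : p ≤ N) (ha : a < ∑ j : Fin p, m j) :
    pos (stdColor m N) p a = a := by
  have := Nat.nth_count (colored_stdColor m hp ha)
  rwa [count_colored_stdColor m hp ha] at this

theorem relPos_stdColor (m : ℕ → ℕ) {N p a : ℕ} (hp : p + 1 ≤ N) (ha : a < ∑ j : Fin p, m j) :
    relPos (stdColor m N) p a = a := by
  rw [relPos, pos_stdColor m (by omega) ha]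
  exact count_colored_stdColor m hp (ha.trans_le (sum_fin_mono m (by omega)))

/-- A sum of products of nearest-neighbour factors can be evaluated one variable at a time, as with
transfer matrices; this turns the simultaneous sum in `W` into `weightRec`. -/
theorem sum_pi_chain {β : ℕ → Type*} [∀ p, Fintype (β p)] (g : ∀ p, β p → β (p + 1) → ℂ)
    (C : ∀ p, β p → ℂ) (hC₀ : ∀ b, C 0 b = 1) (hC : ∀ p b, C (p + 1) b = ∑ a, g p a b * C p a)
    (r : ℕ) (h : β r → ℂ) :
    ∑ σ : (p : Fin (r + 1)) → β p,
        (∏ p : Fin r, g p (σ p.castSucc) (σ p.succ)) * h (σ (Fin.last r))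
      = ∑ b, h b * C r b := by
  induction r with
  | zero =>
    rw [← (Fin.snocEquiv fun p : Fin 1 => β p).sum_comp, Fintype.sum_prod_type]
    refine Finset.sum_congr rfl fun τ _ => ?_
    have h1 : ∀ σ, Fin.snocEquiv (fun p : Fin 1 => β p) (τ, σ) (Fin.last 0) = τ :=
      fun σ => Fin.snoc_last (α := fun p : Fin 1 => β p) τ σ
    rw [Fintype.sum_unique, h1, hC₀]
    simp
  | succ r ih =>
    rw [← (Fin.snocEquiv fun p : Fin (r + 2) => β p).sum_comp, Fintype.sum_prod_type]
    refine Finset.sum_congr rfl fun τ _ => ?_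
    rw [hC, ← ih, Finset.mul_sum]
    refine Finset.sum_congr rfl fun σ _ => ?_
    have h1 : Fin.snocEquiv (fun p : Fin (r + 2) => β p) (τ, σ) (Fin.last (r + 1)) = τ :=
      Fin.snoc_last (α := fun p : Fin (r + 2) => β p) τ σ
    have h2 : ∀ p : Fin (r + 1),
        Fin.snocEquiv (fun p : Fin (r + 2) => β p) (τ, σ) p.castSucc = σ p :=
      fun p => Fin.snoc_castSucc (α := fun p : Fin (r + 2) => β p) τ σ p
    rw [h1, Fin.prod_univ_castSucc]
    have h3 : ∀ p : Fin r, g (p.castSucc : Fin (r + 1))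
        (Fin.snocEquiv (fun p : Fin (r + 2) => β p) (τ, σ) p.castSucc.castSucc)
        (Fin.snocEquiv (fun p : Fin (r + 2) => β p) (τ, σ) p.castSucc.succ)
        = g p (σ p.castSucc) (σ p.succ) :=
      fun p => congrArg₂ (g p) (h2 p.castSucc) (h2 p.succ)
    have h4 : g (Fin.last r : Fin (r + 1))
        (Fin.snocEquiv (fun p : Fin (r + 2) => β p) (τ, σ) (Fin.last r).castSucc)
        (Fin.snocEquiv (fun p : Fin (r + 2) => β p) (τ, σ) (Fin.last r).succ)
        = g r (σ (Fin.last r)) τ :=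
      congrArg₂ (g r) (h2 (Fin.last r)) h1
    rw [Finset.prod_congr rfl fun p _ => h3 p, h4]
    ring

theorem specW_eq_weightRec (r : ℕ) {m : ℕ → ℕ} (u v : (j : ℕ) → Fin (m j) → ℂ) :
    specW r q m u v = weightRec u q (r + 1) (concat v (r + 2)) := by
  have h := sum_pi_chain (β := fun p => Equiv.Perm (Fin (∑ j : Fin (p + 1), m j)))
    (fun p a b => layer q (concat u (p + 1) ∘ a) (concat u (p + 2) ∘ b) (fun i => i))
    (fun p b => weightRec u q p (concat u (p + 1) ∘ b)) (fun _ => rfl) (fun _ _ => rfl) r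
    (fun τ => layer q (concat u (r + 1) ∘ τ) (concat v (r + 2)) (fun i => i))
  refine Eq.trans (Finset.sum_congr rfl fun σ _ => ?_) h
  refine congrArg₂ (· * ·) (Finset.prod_congr rfl fun p _ => ?_) ?_
  · exact congrArg (layer q _ _)
      (funext fun a => relPos_stdColor m (by have := p.isLt; omega) a.isLt)
  · exact congrArg (layer q _ _) (funext fun a => pos_stdColor m (Nat.le_succ _) a.isLt)

/-! ### The normalizing product -/

theorem qDiff_eq_pairProd {k l : ℕ} (x : Fin k → ℂ) (y : Fin l → ℂ) :
    qDiff q x y = pairProd q (List.ofFn x) (List.ofFn y) := by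
  simp only [qDiff, pairProd, List.map_ofFn, List.prod_ofFn]
  rfl

theorem prod_pairProd_left {m : ℕ → ℕ} (u : (j : ℕ) → Fin (m j) → ℂ) (p : ℕ) (ys : List ℂ) :
    ∏ j ∈ Finset.range p, pairProd q (List.ofFn (u j)) ys = pairProd q (paramList u p) ys := by
  induction p with
  | zero => simp [paramList, pairProd]
  | succ p ih => rw [Finset.prod_range_succ, ih, paramList, pairProd_append_left]

theorem prod_pairProd_right {m : ℕ → ℕ} (u : (j : ℕ) → Fin (m j) → ℂ) (p : ℕ) (xs : List ℂ) :
    ∏ j ∈ Finset.range p, pairProd q xs (List.ofFn (u j)) = pairProd q xs (paramList u p) := by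
  induction p with
  | zero => simp [paramList, pairProd, Function.comp_def]
  | succ p ih => rw [Finset.prod_range_succ, ih, paramList, pairProd_append_right]

theorem normRec_eq_prod {m : ℕ → ℕ} (u : (j : ℕ) → Fin (m j) → ℂ) (r : ℕ) :
    normRec u q r
      = ∏ l ∈ Finset.range r, pairProd q (paramList u l) (paramList u (l + 1)) := by
  induction r with
  | zero => simp [normRec]
  | succ r ih => rw [normRec, ih, Finset.prod_range_succ]

theorem denom_eq (r : ℕ) {m : ℕ → ℕ} (u v : (j : ℕ) → Fin (m j) → ℂ) :
    denom r q m u v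
      = pairProd q (paramList u (r + 1)) (List.ofFn (v (r + 1))) * normRec u q (r + 1) := by
  simp only [denom, qDiff_eq_pairProd, prod_pairProd_right]
  simp only [prod_pairProd_left]
  -- The factor with index 0 is an empty product; splitting it off accounts for the index shift
  -- between `normRec` and `denom`.
  rw [normRec_eq_prod, Finset.prod_range_succ']
  simp [paramList, pairProd]

theorem denom_mul_gridH (hq : q ≠ 0) (r : ℕ) {m : ℕ → ℕ} (u v : (j : ℕ) → Fin (m j) → ℂ)
    (hu : Function.Injective (concat u (r + 1))) :
    denom r q m u v * gridH r q m u v = specW r q m u v := by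
  have hs : ∑ j : Fin (r + 2), m j = ∑ j : Fin (r + 1), m j + m (r + 1) :=
    Fin.sum_univ_castSucc _
  have h := normRec_mul_create u hq (r + 1) hu (concat v (r + 2)) (by omega)
  rw [ofFn_concat, paramList,
    show ∑ j : Fin (r + 2), m j - ∑ j : Fin (r + 1), m j = (List.ofFn (v (r + 1))).length by
      rw [List.length_ofFn]; omega,
    create_append_replicate _ _ _ (by simp [length_paramList, length_colorList]),
    map_fst_opList] at h
  rw [specW_eq_weightRec, ← h, gridH_eq_create, denom_eq]
  ring

end TrigWeight

end

theorem proposition3p3 (r : ℕ) (q : ℂ) (hq : q ≠ 0) (m : ℕ → ℕ)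
    (u v : (j : ℕ) → Fin (m j) → ℂ)
    (hu : Function.Injective (TrigWeight.concat u (r + 1)))
    (hD : TrigWeight.denom r q m u v ≠ 0) :
    TrigWeight.gridH r q m u v
      = 1 / TrigWeight.denom r q m u v * TrigWeight.specW r q m u v := by
  rw [← TrigWeight.denom_mul_gridH hq r u v hu, one_div, inv_mul_cancel_left₀ hD]
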